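/- Let $Y$ be a (open) three holed sphere with boundary curves $\alpha,\beta,\gamma$, whose homotopy classes are chosen so that $\pi_1(Y)=\langle[\alpha],[\beta],[\gamma] : [\gamma][\beta][\alpha]=1\rangle$. Let $\mathrm{SO}_0(2,1)<\mathrm{SL}(3,\mathbb{R})$ be the identity component of the special orthogonal group of the form $2z_1z_3+z_2^2$ of signature $(2,1)$, acting on the hyperbolic plane $\mathbf{H}^2$ by orientation preserving isometries. Let $\rho:\pi_1(Y)\to\Gamma=\rho(\pi_1(Y))<\mathrm{SO}_0(2,1)$ be a Fuchsian representation, that is, $\Gamma$ acts freely and properly discontinuously on $\mathbf{H}^2$ and there is a homeomorphism $\mathbf{H}^2/\Gamma\to Y$ which induces $\rho$ (that is, $\rho$ is the resulting identification of $\pi_1(Y)$ with the deck group $\Gamma$). Write $A=\rho([\alpha])$, $B=\rho([\beta])$, $C=\rho([\gamma])$, so $CBA=I$, and define the shape invariants $$\sigma_+=\mathrm{tr}(A^{-1}B)-\mathrm{tr}(A^{-1})\,\mathrm{tr}(B),\qquad \sigma_-=\mathrm{tr}(B^{-1}A)-\mathrm{tr}(B^{-1})\,\mathrm{tr}(A).$$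 Then $(\mathrm{tr}(A)+1)(\mathrm{tr}(B)+1)(\mathrm{tr}(C)+1)>0$ and, taking the positive square root and writing $[A,B]=ABA^{-1}B^{-1}$, $$\sigma_+=\sigma_-=\mathrm{tr}(A)+\mathrm{tr}(B)+\mathrm{tr}(C)+1+2\sqrt{(\mathrm{tr}(A)+1)(\mathrm{tr}(B)+1)(\mathrm{tr}(C)+1)},$$ $$\mathrm{tr}[A,B]=\Bigl(\mathrm{tr}(A)+\mathrm{tr}(B)+\mathrm{tr}(C)+1+\sqrt{(\mathrm{tr}(A)+1)(\mathrm{tr}(B)+1)(\mathrm{tr}(C)+1)}\Bigr)^2-1.$$ -/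

import Mathlib

open Matrix Topology

namespace Pants

/-- The symmetric matrix `J` of signature `(2,1)`; the form is `zᵀ J z = 2 z₁ z₃ + z₂²`. -/
def J : Matrix (Fin 3) (Fin 3) ℝ := !![0, 0, 1; 0, 1, 0; 1, 0, 0]

/-- `SO(2,1)`, as the special orthogonal group of `J`. -/
def SO21 : Subgroup (SpecialLinearGroup (Fin 3) ℝ) where
  carrier := {A | A.1ᵀ * J * A.1 = J}
  one_mem' := by simp
  mul_mem' := by
    intro A B hA hB
    change A.1ᵀ * J * A.1 = J at hA
    change B.1ᵀ * J * B.1 = J at hB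
    change (A.1 * B.1)ᵀ * J * (A.1 * B.1) = J
    calc _ = B.1ᵀ * (A.1ᵀ * J * A.1) * B.1 := by
          simp only [transpose_mul, Matrix.mul_assoc]
      _ = J := by rw [hA, hB]
  inv_mem' := by
    intro A hA
    change A.1ᵀ * J * A.1 = J at hA
    have h1 : A.1 * (A⁻¹).1 = 1 := congrArg Subtype.val (mul_inv_cancel A)
    have h2 : (A⁻¹).1ᵀ * A.1ᵀ = 1 := by rw [← transpose_mul, h1, transpose_one]
    change (A⁻¹).1ᵀ * J * (A⁻¹).1 = J
    calc (A⁻¹).1ᵀ * J * (A⁻¹).1 = (A⁻¹).1ᵀ * (A.1ᵀ * J * A.1) * (A⁻¹).1 := by rw [hA]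
      _ = ((A⁻¹).1ᵀ * A.1ᵀ) * J * (A.1 * (A⁻¹).1) := by
          simp only [Matrix.mul_assoc]
      _ = J := by rw [h1, h2, Matrix.one_mul, Matrix.mul_one]

/-- `SO₀(2,1)`, the identity component of `SO(2,1)`. -/
def SO21₀ : Subgroup SO21 := Subgroup.connectedComponentOfOne SO21

/-- The underlying element of `SL(3,ℝ)` of an element of `SO₀(2,1)`. -/
def toSL (A : SO21₀) : SpecialLinearGroup (Fin 3) ℝ := A.1.1

/-- The hyperboloid model of the hyperbolic plane: one sheet of `{z | zᵀ J z = -1}`. -/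
def HypPlane : Type := {z : Fin 3 → ℝ // z ⬝ᵥ (J *ᵥ z) = -1 ∧ 0 < z 2}

instance : TopologicalSpace HypPlane := inferInstanceAs (TopologicalSpace (Subtype _))

theorem last_ne_zero {z : Fin 3 → ℝ} (hz : z ⬝ᵥ (J *ᵥ z) = -1) : z 2 ≠ 0 := by
  intro h
  simp [J, dotProduct, mulVec, Fin.sum_univ_three, h] at hz
  nlinarith [mul_self_nonneg (z 1)]

theorem form_mulVec (A : SO21) (z : Fin 3 → ℝ) :
    (A.1.1 *ᵥ z) ⬝ᵥ (J *ᵥ (A.1.1 *ᵥ z)) = z ⬝ᵥ (J *ᵥ z) := by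
  have hA : A.1.1ᵀ * J * A.1.1 = J := A.2
  rw [mulVec_mulVec, dotProduct_comm, dotProduct_mulVec, ← mulVec_transpose, mulVec_mulVec,
    dotProduct_comm]
  congr 2
  rw [← Matrix.mul_assoc, hA]

/-- The identity component preserves the chosen sheet of the hyperboloid. -/
theorem last_pos (A : SO21₀) (z : HypPlane) : 0 < (A.1.1.1 *ᵥ z.1) 2 := by
  have hc : IsPreconnected (SO21₀ : Set SO21) := isPreconnected_connectedComponent
  have hf : Continuous fun B : SO21 ↦ (B.1.1 *ᵥ z.1) 2 := by
    have : Continuous fun B : SO21 ↦ B.1.1 :=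
      (continuous_subtype_val.comp continuous_subtype_val)
    fun_prop
  have hi := hc.image _ hf.continuousOn
  by_contra hneg
  have h1 : z.1 2 ∈ (fun B : SO21 ↦ (B.1.1 *ᵥ z.1) 2) '' (SO21₀ : Set SO21) :=
    ⟨1, SO21₀.one_mem, by simp⟩
  have h2 : (A.1.1.1 *ᵥ z.1) 2 ∈ (fun B : SO21 ↦ (B.1.1 *ᵥ z.1) 2) '' (SO21₀ : Set SO21) :=
    ⟨A.1, A.2, rfl⟩
  obtain ⟨B, -, hB⟩ := hi.Icc_subset h2 h1 ⟨not_lt.mp hneg, z.2.2.le⟩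
  exact last_ne_zero (form_mulVec B z.1 ▸ z.2.1) hB

/-- The action of `SO₀(2,1)` on the hyperbolic plane by orientation preserving isometries. -/
instance : MulAction SO21₀ HypPlane where
  smul A z := ⟨A.1.1.1 *ᵥ z.1, (form_mulVec A.1 z.1).trans z.2.1, last_pos A z⟩
  one_smul z := Subtype.ext (one_mulVec z.1)
  mul_smul A B z := Subtype.ext (mulVec_mulVec z.1 A.1.1.1 B.1.1.1).symm

/-- The standard (open) three holed sphere: the disc `|z| < 3` in the plane with the two holes
`|z + 1| ≤ 1/2` and `|z - 1| ≤ 1/2` removed. -/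
def stdPants : Set ℂ := {z | ‖z‖ < 3 ∧ 1 / 2 < ‖z + 1‖ ∧ 1 / 2 < ‖z - 1‖}

/-- `Y` is a three holed sphere, and `α`, `β`, `γ` are the homotopy classes of its three boundary
curves, chosen so that `π₁(Y) = ⟨α, β, γ | γ β α = 1⟩`.  That is, some homeomorphism from `Y` to
the standard model carries `α`, `β` to the circles `|z + 1| = 1` and `|z - 1| = 1` through the
base point `0`, each run once anticlockwise (these go around the two inner boundary components),
and `γ` is the inverse of their product (it goes once clockwise around the outer one).
In `FundamentalGroup` the product `β * α` is the class of `α` followed by `β`. -/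
def IsThreeHoledSphere {Y : Type*} [TopologicalSpace Y] {y₀ : Y}
    (α β γ : FundamentalGroup Y y₀) : Prop :=
  ∃ (φ : Y ≃ₜ stdPants) (a b : Path y₀ y₀),
    (∀ t : unitInterval, (φ (a t) : ℂ) = -1 + Complex.exp (2 * Real.pi * (t : ℝ) * Complex.I)) ∧
    (∀ t : unitInterval, (φ (b t) : ℂ) = 1 - Complex.exp (2 * Real.pi * (t : ℝ) * Complex.I)) ∧
    α = FundamentalGroup.fromPath (Path.Homotopic.Quotient.mk a) ∧
    β = FundamentalGroup.fromPath (Path.Homotopic.Quotient.mk b) ∧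
    γ * β * α = 1

/-- The projection from the hyperbolic plane to its quotient by `Γ`. -/
abbrev proj (Γ : Subgroup SO21₀) : HypPlane → Quotient (MulAction.orbitRel Γ HypPlane) :=
  Quotient.mk (MulAction.orbitRel Γ HypPlane)

/-- `ρ : π₁(Y) → Γ < SO₀(2,1)` is a Fuchsian representation: `Γ` acts freely and properly
discontinuously on the hyperbolic plane (as a covering group), and there is a homeomorphism `f`
from the quotient by `Γ` to `Y` that induces `ρ`, i.e. `ρ` is the identification of `π₁(Y)` with the
group of deck transformations `Γ`: for every `g` in `π₁(Y)`, the loop `g` is the image of a path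
joining `x₀` and `ρ(g) x₀`.  The path runs from `ρ(g) x₀` to `x₀` because `g * h` is `h` followed
by `g` in `FundamentalGroup`.  (Such a `ρ` is faithful with discrete image.) -/
def IsFuchsian {Y : Type*} [TopologicalSpace Y] {y₀ : Y}
    (ρ : FundamentalGroup Y y₀ →* SO21₀) : Prop :=
  IsQuotientCoveringMap (proj ρ.range) ρ.range ∧
  ∃ (f : Quotient (MulAction.orbitRel ρ.range HypPlane) ≃ₜ Y) (x₀ : HypPlane),
    f (proj ρ.range x₀) = y₀ ∧
    ∀ g : FundamentalGroup Y y₀, ∃ (c : Path (ρ g • x₀) x₀) (d : Path y₀ y₀),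
      (∀ t, d t = f (proj ρ.range (c t))) ∧
      FundamentalGroup.fromPath (Path.Homotopic.Quotient.mk d) = g

/-- The trace of an element of `SL(3,R)`. -/
def tr {R : Type*} [CommRing R] (A : SpecialLinearGroup (Fin 3) R) : R := A.1.trace

/-- The shape invariant `σ₊` of a triple with `C B A = I`. -/
def shapePlus {R : Type*} [CommRing R] (A B _C : SpecialLinearGroup (Fin 3) R) : R :=
  tr (A⁻¹ * B) - tr A⁻¹ * tr B

/-- The shape invariant `σ₋` of a triple with `C B A = I`. -/
def shapeMinus {R : Type*} [CommRing R] (A B _C : SpecialLinearGroup (Fin 3) R) : R :=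
  tr (B⁻¹ * A) - tr B⁻¹ * tr A

end Pants

/-! The symmetric square `symSq` maps SL(2,ℝ) onto `SO21₀`, and a lift g of G satisfies tr G = (tr
g)² - 1. Choose lifts a, b of A, B, so that (ba)⁻¹ lifts C, and let x, y, z be the traces of a, b,
ba. Then tr A + 1 = x², tr B + 1 = y² and tr C + 1 = z². The Cayley-Hamilton and Fricke identities
give σ₊ = σ₋ = x² + y² + z² - 2 - 2xyz and tr[a,b] = x² + y² + z² - xyz - 2. The theorem therefore
reduces to xyz < 0, which makes the square root equal to -xyz.

The sign comes from a spin structure. Composing the covering with the planar model of Y gives a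
locally injective map F : ℍ → ℂ invariant under Γ (`projToPlane`). F is only continuous, so its
derivative is replaced by difference quotients: on pairs of nearby distinct points there is a
continuous h with h² · `discCoord` = F(q) - F(p) (`exists_spinRoot`). Every element of Γ has a lift
that transforms h by its unitary automorphy factor (`IsSpinLift`), and products of such lifts are
again such lifts.

The decisive fact is `IsSpinLift.trace_neg`: if a curve translated by g projects to a round circle,
the spin lift of g has negative trace. Along the circle the short chord turns once, so its square
root changes sign. By continuity the same sign occurs for the chord from p to g•p. If the trace were
positive, an intermediate value argument would find p for which this chord points at a boundary
fixed point of g towards which g does not move points, a contradiction.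

The loops α, β and βα are freely homotopic to round circles around one hole, the other, and both.
The spin lifts a, b, ba thus all have negative trace (`exists_lifts_trace_neg`), and xyz < 0. -/

namespace Pants

open UpperHalfPlane ComplexConjugate Matrix.SpecialLinearGroup

/-! ### Automorphy factors and disc coordinates on the upper half plane. -/

/-- The automorphy factor `cp + d` of a real unimodular matrix. -/
noncomputable def autFactor (g : SpecialLinearGroup (Fin 2) ℝ) (p : ℍ) : ℂ := g.1 1 0 * p + g.1 1 1

/-- The Poincaré disc coordinate of `q` centred at `p`. -/
noncomputable def discCoord (p q : ℍ) : ℂ := (q - p) / (q - conj (p : ℂ))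

theorem det_expand (g : SpecialLinearGroup (Fin 2) ℝ) :
    g.1 0 0 * g.1 1 1 - g.1 0 1 * g.1 1 0 = 1 := by
  have := g.2; rwa [det_fin_two] at this

theorem autFactor_ne_zero (g : SpecialLinearGroup (Fin 2) ℝ) (p : ℍ) : autFactor g p ≠ 0 := by
  intro h
  have him := congrArg Complex.im h
  have hre := congrArg Complex.re h
  have hp := p.im_pos
  simp [autFactor] at him hre
  have hd := det_expand g
  rcases him with h0 | h0
  · rw [h0] at hre hd; simp at hre; rw [hre] at hd; simp at hd
  · exact hp.ne' h0

theorem coe_smul_mul (g : SpecialLinearGroup (Fin 2) ℝ) (p : ℍ) :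
    ((g • p : ℍ) : ℂ) * autFactor g p = g.1 0 0 * p + g.1 0 1 := by
  have := autFactor_ne_zero g p
  rw [UpperHalfPlane.coe_specialLinearGroup_apply]
  exact div_mul_cancel₀ _ this

theorem autFactor_mul (g h : SpecialLinearGroup (Fin 2) ℝ) (p : ℍ) :
    autFactor (g * h) p = autFactor g (h • p) * autFactor h p := by
  have := coe_smul_mul h p
  have e : autFactor g (h • p) * autFactor h p
      = g.1 1 0 * (((h • p : ℍ) : ℂ) * autFactor h p) + g.1 1 1 * autFactor h p := by
    simp only [autFactor]; ring
  rw [e, this]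
  simp [autFactor, Matrix.mul_apply, Fin.sum_univ_two]
  ring

theorem autFactor_neg (g : SpecialLinearGroup (Fin 2) ℝ) (p : ℍ) :
    autFactor (-g) p = - autFactor g p := by
  simp [autFactor]; ring

theorem autFactor_one (p : ℍ) : autFactor 1 p = 1 := by
  simp [autFactor]

theorem continuous_autFactor (g : SpecialLinearGroup (Fin 2) ℝ) : Continuous (autFactor g) := by
  unfold autFactor
  have := UpperHalfPlane.continuous_coe
  fun_prop

theorem sub_conj_ne_zero (p q : ℍ) : (q : ℂ) - conj (p : ℂ) ≠ 0 := by
  intro h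
  have := congrArg Complex.im h
  have hp := p.im_pos
  have hq := q.im_pos
  simp at this
  linarith

theorem discCoord_eq_zero {p q : ℍ} : discCoord p q = 0 ↔ p = q := by
  rw [discCoord, div_eq_zero_iff, or_iff_left (sub_conj_ne_zero p q), sub_eq_zero]
  exact ⟨fun h => (UpperHalfPlane.ext h).symm, fun h => by rw [h]⟩

/-- A real Möbius map divides the difference of two points by the product of their automorphy
factors, and this also applies to the pair formed by q and the conjugate of p. The factor of q
cancels in the quotient. -/
theorem discCoord_smul (g : SpecialLinearGroup (Fin 2) ℝ) (p q : ℍ) :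
    discCoord (g • p) (g • q) = discCoord p q * (conj (autFactor g p) / autFactor g p) := by
  have hp := coe_smul_mul g p
  have hq := coe_smul_mul g q
  have jp := autFactor_ne_zero g p
  have jq := autFactor_ne_zero g q
  have jp' : conj (autFactor g p) ≠ 0 := by simpa using jp
  have hd : (g.1 0 0 * g.1 1 1 - g.1 0 1 * g.1 1 0 : ℂ) = 1 := by exact_mod_cast det_expand g
  have hp' := congrArg conj hp
  simp only [map_mul, map_add, Complex.conj_ofReal] at hp'
  have e1 : ((g • q : ℍ) - (g • p : ℍ) : ℂ) * (autFactor g p * autFactor g q) = q - p := by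
    calc _ = ((g • q : ℍ) : ℂ) * autFactor g q * autFactor g p
          - ((g • p : ℍ) : ℂ) * autFactor g p * autFactor g q := by ring
      _ = (g.1 0 0 * g.1 1 1 - g.1 0 1 * g.1 1 0 : ℂ) * (q - p) := by
          rw [hp, hq]; simp only [autFactor]; ring
      _ = _ := by rw [hd, one_mul]
  have e2 : ((g • q : ℍ) - conj ((g • p : ℍ) : ℂ)) * (conj (autFactor g p) * autFactor g q)
      = q - conj (p : ℂ) := by
    calc _ = ((g • q : ℍ) : ℂ) * autFactor g q * conj (autFactor g p)
          - (conj ((g • p : ℍ) : ℂ) * conj (autFactor g p)) * autFactor g q := by ring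
      _ = (g.1 0 0 * g.1 1 1 - g.1 0 1 * g.1 1 0 : ℂ) * (q - conj (p : ℂ)) := by
          rw [hp', hq]; simp only [autFactor, map_add, map_mul, Complex.conj_ofReal]; ring
      _ = _ := by rw [hd, one_mul]
  have n1 := sub_conj_ne_zero p q
  have n2 := sub_conj_ne_zero (g • p) (g • q)
  unfold discCoord
  rw [← e1, ← e2]
  field_simp

theorem norm_discCoord (p q : ℍ) : ‖discCoord p q‖ = Real.tanh (dist p q / 2) := by
  rw [UpperHalfPlane.dist_comm, UpperHalfPlane.tanh_half_dist, discCoord, norm_div,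
    dist_eq_norm, dist_eq_norm]

theorem continuous_discCoord : Continuous fun x : ℍ × ℍ => discCoord x.1 x.2 := by
  have := UpperHalfPlane.continuous_coe
  unfold discCoord
  refine Continuous.div (by fun_prop) ?_ fun x => sub_conj_ne_zero _ _
  have : Continuous fun z : ℂ => conj z := Complex.continuous_conj
  fun_prop

theorem discPoint_im (p : ℍ) (w : ℂ) (hw : ‖w‖ < 1) :
    0 < (((p : ℂ) - w * conj (p : ℂ)) / (1 - w)).im := by
  have h1 : (1 - w) ≠ 0 := by
    intro h; rw [← sub_eq_zero.1 h] at hw; simp at hw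
  have hn : Complex.normSq w < 1 := by
    rw [Complex.normSq_eq_norm_sq]; nlinarith [norm_nonneg w]
  have hpos := Complex.normSq_pos.2 h1
  have hp := p.im_pos
  rw [Complex.div_im, ← sub_div]
  apply div_pos _ hpos
  rw [Complex.normSq_apply] at hn
  simp
  nlinarith

open Classical in
/-- The point whose disc coordinate centred at `p` is `w`. -/
noncomputable def discPoint (p : ℍ) (w : ℂ) : ℍ :=
  if hw : ‖w‖ < 1 then ⟨((p : ℂ) - w * conj (p : ℂ)) / (1 - w), discPoint_im p w hw⟩ else p

theorem one_sub_ne_zero {w : ℂ} (hw : ‖w‖ < 1) : 1 - w ≠ 0 := by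
  intro h; rw [← sub_eq_zero.1 h] at hw; simp at hw

theorem discPoint_coe (p : ℍ) {w : ℂ} (hw : ‖w‖ < 1) :
    (discPoint p w : ℂ) = ((p : ℂ) - w * conj (p : ℂ)) / (1 - w) := by
  rw [discPoint, dif_pos hw]

theorem coe_sub_conj_ne_zero (p : ℍ) : (p : ℂ) - conj (p : ℂ) ≠ 0 := sub_conj_ne_zero p p

theorem discCoord_discPoint (p : ℍ) {w : ℂ} (hw : ‖w‖ < 1) :
    discCoord p (discPoint p w) = w := by
  have h1 := one_sub_ne_zero hw
  have h2 := coe_sub_conj_ne_zero p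
  have e1 : ((discPoint p w : ℍ) : ℂ) - p = w * (p - conj (p : ℂ)) / (1 - w) := by
    rw [discPoint_coe p hw]; field_simp; ring
  have e2 : ((discPoint p w : ℍ) : ℂ) - conj (p : ℂ) = (p - conj (p : ℂ)) / (1 - w) := by
    rw [discPoint_coe p hw]; field_simp; ring
  rw [discCoord, e1, e2]
  field_simp

theorem norm_discCoord_lt_one (p q : ℍ) : ‖discCoord p q‖ < 1 := by
  rw [norm_discCoord]; exact Real.tanh_lt_one _

theorem discPoint_discCoord (p q : ℍ) : discPoint p (discCoord p q) = q := by
  apply UpperHalfPlane.ext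
  have hw := norm_discCoord_lt_one p q
  have h1 := one_sub_ne_zero hw
  have h2 := coe_sub_conj_ne_zero p
  have h3 := sub_conj_ne_zero p q
  rw [discPoint_coe p hw, div_eq_iff h1]
  unfold discCoord
  field_simp
  ring

theorem continuous_discPoint {X : Type*} [TopologicalSpace X] {f : X → ℍ} {w : X → ℂ}
    (hf : Continuous f) (hw : Continuous w) (h : ∀ x, ‖w x‖ < 1) :
    Continuous fun x => discPoint (f x) (w x) := by
  rw [UpperHalfPlane.isEmbedding_coe.continuous_iff]
  have := UpperHalfPlane.continuous_coe.comp hf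
  have h2 : Continuous fun x => conj (f x : ℂ) := Complex.continuous_conj.comp this
  have e : ((↑) : ℍ → ℂ) ∘ (fun x => discPoint (f x) (w x))
      = fun x => ((f x : ℂ) - w x * conj (f x : ℂ)) / (1 - w x) :=
    funext fun x => discPoint_coe _ (h x)
  rw [e]
  exact Continuous.div (this.sub (hw.mul h2)) (by fun_prop) fun x => one_sub_ne_zero (h x)

/-! ### Continuous square roots. -/

theorem exists_log {X : Type*} [TopologicalSpace X] [SimplyConnectedSpace X]
    [LocallyPathConnectedSpace X] {f : X → ℂ} (hf : Continuous f) (h0 : ∀ x, f x ≠ 0) :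
    ∃ L : X → ℂ, Continuous L ∧ ∀ x, Complex.exp (L x) = f x := by
  obtain ⟨x₀⟩ := (inferInstance : Nonempty X)
  have h : Complex.exp (Complex.log (f x₀)) = f x₀ := Complex.exp_log (h0 x₀)
  obtain ⟨L, hL, -⟩ := Complex.isCoveringMap_exp.existsUnique_continuousMap_lifts
    ⟨fun x => (⟨f x, h0 x⟩ : {z : ℂ // z ≠ 0}), by fun_prop⟩ x₀ (Complex.log (f x₀))
    (Subtype.ext h)
  exact ⟨L, L.continuous, fun x => congrArg Subtype.val (congrFun hL.2 x)⟩

theorem exists_sqrt {X : Type*} [TopologicalSpace X] [SimplyConnectedSpace X]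
    [LocallyPathConnectedSpace X] {f : X → ℂ} (hf : Continuous f) (h0 : ∀ x, f x ≠ 0) :
    ∃ k : X → ℂ, Continuous k ∧ ∀ x, k x ^ 2 = f x := by
  obtain ⟨L, hL, h⟩ := exists_log hf h0
  refine ⟨fun x => Complex.exp (L x / 2), by fun_prop, fun x => ?_⟩
  rw [← h, ← Complex.exp_nat_mul]
  congr 1
  push_cast
  ring

/-- The quotient u/v is continuous and takes values among the at most two square roots of c, so it
is constant on a connected space. This is how every sign in the sequel is transported. -/
theorem exists_const_ratio {X : Type*} [TopologicalSpace X] [PreconnectedSpace X] [Nonempty X]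
    {u v : X → ℂ} (hu : Continuous u) (hv : Continuous v) (h0 : ∀ x, v x ≠ 0) {c : ℂ}
    (h : ∀ x, u x ^ 2 = c * v x ^ 2) : ∃ ε : ℂ, ε ^ 2 = c ∧ ∀ x, u x = ε * v x := by
  obtain ⟨d, hd⟩ := IsAlgClosed.exists_pow_nat_eq c (n := 2) (by norm_num)
  by_cases hd0 : d = 0
  · refine ⟨0, by rw [← hd, hd0], fun x => ?_⟩
    have := h x
    rw [← hd, hd0] at this
    simpa using this
  · have := isPreconnected_univ.eq_or_eq_neg_of_sq_eq (S := (Set.univ : Set X)) (f := u)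
      (g := fun x => d * v x) hu.continuousOn (by fun_prop)
      (fun x _ => by simp [h x, ← hd, mul_pow]) (fun {x} _ => mul_ne_zero hd0 (h0 x))
    rcases this with h1 | h1
    · exact ⟨d, hd, fun x => h1 (Set.mem_univ x)⟩
    · exact ⟨-d, by rw [neg_sq, hd], fun x => by simpa using h1 (Set.mem_univ x)⟩

theorem norm_exp_I_mul_lt (z : ℍ) : ‖Complex.exp (Complex.I * z)‖ < 1 := by
  rw [Complex.norm_exp]
  simpa using z.im_pos

theorem norm_ofReal_mul_exp {τ : ℝ} (h0 : 0 < τ) (z : ℍ) :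
    ‖(τ : ℂ) * Complex.exp (Complex.I * z)‖ < τ := by
  rw [norm_mul, Complex.norm_real, Real.norm_of_nonneg h0.le]
  exact mul_lt_of_lt_one_right h0 (norm_exp_I_mul_lt z)

/-! ### The spinorial root of a locally injective map. -/

/-- A square root of the difference `F q - F p`, as `q` runs once around `p`, changes its sign. -/
theorem sqrt_sub_antiperiodic {F : ℍ → ℂ} (hF : Continuous F) {p : ℍ} {w : ℂ} (hw : ‖w‖ < 1)
    (hw0 : w ≠ 0)
    (hinj : Set.InjOn F {q | ‖discCoord p q‖ ≤ ‖w‖}) {k : ℝ → ℂ} (hk : Continuous k)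
    (hsq : ∀ θ : ℝ, k θ ^ 2 = F (discPoint p (w * Complex.exp (θ * Complex.I))) - F p) :
    k (2 * Real.pi) = - k 0 := by
  set e : ℝ → ℂ := fun θ => w * Complex.exp (θ * Complex.I) with he
  have hec : Continuous e := by fun_prop
  have hen : ∀ θ, ‖e θ‖ = ‖w‖ := fun θ => by simp [he, Complex.norm_exp_ofReal_mul_I]
  have he0 : ∀ θ, e θ ≠ 0 := fun θ => mul_ne_zero hw0 (Complex.exp_ne_zero _)
  -- Clamping the parameter to [0, 1/2] keeps the domain equal to the simply connected plane.
  set s : ℝ → ℝ := fun x => max 0 (min x (1 / 2)) with hs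
  have hs0 : ∀ x, 0 ≤ s x := fun x => le_max_left _ _
  have hs1 : ∀ x, s x ≤ 1 / 2 := fun x => max_le (by norm_num) (min_le_right _ _)
  have hsc : Continuous s := by fun_prop
  have n1 : ∀ x θ, ‖((1 - s x : ℝ) : ℂ) * e θ‖ ≤ ‖w‖ := fun x θ => by
    rw [norm_mul, hen, Complex.norm_real, Real.norm_of_nonneg (by linarith [hs1 x])]
    exact mul_le_of_le_one_left (norm_nonneg _) (by linarith [hs0 x])
  have n2 : ∀ x θ, ‖((-s x : ℝ) : ℂ) * e θ‖ ≤ ‖w‖ := fun x θ => by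
    rw [norm_mul, hen, Complex.norm_real, norm_neg, Real.norm_of_nonneg (hs0 x)]
    exact mul_le_of_le_one_left (norm_nonneg _) (by linarith [hs1 x])
  -- The pair (centre, boundary point) is slid to a pair of antipodal points. At s = 1/2 a half turn
  -- swaps the two points and negates f, so the square root `m` is multiplied by a square root of -1
  -- and a full turn multiplies it by -1. The full-turn factor `ε₁` does not depend on s, so it is
  -- also -1 at s = 0.
  set f : ℝ × ℝ → ℂ := fun y => F (discPoint p (((1 - s y.1 : ℝ) : ℂ) * e y.2))
    - F (discPoint p (((-s y.1 : ℝ) : ℂ) * e y.2)) with hf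
  have hfc : Continuous f := by
    refine Continuous.sub (hF.comp (continuous_discPoint continuous_const (by fun_prop)
      fun y => (n1 _ _).trans_lt hw)) (hF.comp (continuous_discPoint continuous_const
      (by fun_prop) fun y => (n2 _ _).trans_lt hw))
  have hf0 : ∀ y, f y ≠ 0 := by
    intro y hy
    have h1 := (n1 y.1 y.2).trans_lt hw
    have h2 := (n2 y.1 y.2).trans_lt hw
    have := hinj (by rw [Set.mem_ofPred, discCoord_discPoint p h1]; exact n1 _ _)
      (by rw [Set.mem_ofPred, discCoord_discPoint p h2]; exact n2 _ _) (sub_eq_zero.1 hy)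
    have := congrArg (discCoord p) this
    rw [discCoord_discPoint p h1, discCoord_discPoint p h2] at this
    have := mul_right_cancel₀ (he0 _) this
    have := Complex.ofReal_injective this
    linarith
  obtain ⟨m, hmc, hm⟩ := exists_sqrt hfc hf0
  have hm0 : ∀ y, m y ≠ 0 := fun y hy => hf0 y (by rw [← hm, hy]; simp)
  have hper : ∀ θ, e (θ + 2 * Real.pi) = e θ := fun θ => by
    simp only [he]; push_cast; rw [add_mul, Complex.exp_add, Complex.exp_two_pi_mul_I, mul_one]
  have hanti : ∀ θ, e (θ + Real.pi) = - e θ := fun θ => by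
    simp only [he]; push_cast; rw [add_mul, Complex.exp_add, Complex.exp_pi_mul_I]; ring
  have s0 : s 0 = 0 := by simp [hs]
  have sh : s (1 / 2) = 1 / 2 := by simp [hs]
  obtain ⟨ε₁, -, h1⟩ := exists_const_ratio (u := fun x => m (x, 0 + 2 * Real.pi))
    (v := fun x => m (x, 0)) (c := 1) (by fun_prop) (by fun_prop) (fun x => hm0 _)
    (fun x => by rw [hm, hm, one_mul]; simp only [hf, hper])
  obtain ⟨ε₂, h2', h2⟩ := exists_const_ratio (u := fun θ => m (1 / 2, θ + Real.pi))
    (v := fun θ => m (1 / 2, θ)) (c := -1) (by fun_prop) (by fun_prop) (fun x => hm0 _)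
    (fun θ => by
      rw [hm, hm]; simp only [hf, hanti, sh]
      have a1 : ((1 - 1 / 2 : ℝ) : ℂ) * -e θ = ((-(1 / 2) : ℝ) : ℂ) * e θ := by push_cast; ring
      have a2 : ((-(1 / 2) : ℝ) : ℂ) * -e θ = ((1 - 1 / 2 : ℝ) : ℂ) * e θ := by push_cast; ring
      rw [a1, a2]; ring)
  obtain ⟨ε₃, -, h3⟩ := exists_const_ratio (u := k)
    (v := fun θ => m (0, θ)) (c := 1) (by fun_prop) (by fun_prop) (fun x => hm0 _)
    (fun θ => by
      rw [hm, hsq]; simp only [hf, s0]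
      have : discPoint p 0 = p := by
        have := discPoint_discCoord p p
        rwa [discCoord_eq_zero.2 rfl] at this
      simp [this, he])
  have e1 := h1 (1 / 2)
  have e2 := h2 (0 + Real.pi)
  have e3 := h2 0
  rw [e3, ← mul_assoc, ← sq, h2', show (0 : ℝ) + Real.pi + Real.pi = 0 + 2 * Real.pi by ring,
    e1] at e2
  have hε : ε₁ = -1 := mul_right_cancel₀ (hm0 _) e2
  have e4 := h1 0
  simp only [hε, zero_add] at e4
  rw [h3, h3, e4]
  ring

theorem add_real_im_pos (z : ℍ) (t : ℝ) : 0 < ((z : ℂ) + t).im := by simpa using z.im_pos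

/-- The set of pairs of distinct points which are closer than prescribed by `τ`. -/
def nearPairs (τ : ℍ → ℝ) : Set (ℍ × ℍ) :=
  {x | 0 < ‖discCoord x.1 x.2‖ ∧ ‖discCoord x.1 x.2‖ < τ x.1}

/-- The fibres of `nearPairs` are punctured discs, so the root is built on their universal covers,
parametrised by τ·exp(iz) with z in ℍ. The root of the numerator changes sign under z ↦ z + 2π, and
so does exp(iz/2), the root of the denominator. Their quotient is periodic and descends. -/
theorem exists_spinRoot {F : ℍ → ℂ} (hF : Continuous F) {τ : ℍ → ℝ} (hτ : Continuous τ)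
    (h0 : ∀ p, 0 < τ p) (h1 : ∀ p, τ p ≤ 1)
    (hinj : ∀ p, Set.InjOn F {q | ‖discCoord p q‖ < τ p}) :
    ∃ h : ℍ × ℍ → ℂ, ContinuousOn h (nearPairs τ) ∧
      ∀ x ∈ nearPairs τ, h x ^ 2 * discCoord x.1 x.2 = F x.2 - F x.1 := by
  set w : ℍ × ℍ → ℂ := fun x => (τ x.1 : ℂ) * Complex.exp (Complex.I * x.2) with hw
  have hwc : Continuous w := by
    have := UpperHalfPlane.continuous_coe
    fun_prop
  have hwτ : ∀ x, ‖w x‖ < τ x.1 := fun x => norm_ofReal_mul_exp (h0 _) _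
  have hw1 : ∀ x, ‖w x‖ < 1 := fun x => (hwτ x).trans_le (h1 _)
  have hw0 : ∀ x, w x ≠ 0 := fun x =>
    mul_ne_zero (Complex.ofReal_ne_zero.2 (h0 _).ne') (Complex.exp_ne_zero _)
  set E : ℍ × ℍ → ℂ := fun x => F (discPoint x.1 (w x)) - F x.1 with hE
  have hEc : Continuous E := (hF.comp (continuous_discPoint continuous_fst hwc hw1)).sub
    (hF.comp continuous_fst)
  have hdiag : ∀ p, discCoord p p = 0 := fun p => discCoord_eq_zero.2 rfl
  have hE0 : ∀ x, E x ≠ 0 := by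
    intro x hx
    have := hinj x.1 (by rw [Set.mem_ofPred, discCoord_discPoint _ (hw1 x)]; exact hwτ x)
      (by rw [Set.mem_ofPred, hdiag, norm_zero]; exact h0 _) (sub_eq_zero.1 hx)
    have := congrArg (discCoord x.1) this
    rw [discCoord_discPoint _ (hw1 x), hdiag] at this
    exact hw0 x this
  obtain ⟨k, hkc, hk⟩ := exists_sqrt hEc hE0
  have hanti : ∀ (p z z' : ℍ), (z' : ℂ) = z + 2 * Real.pi → k (p, z') = - k (p, z) := by
    intro p z z' hz
    have := sqrt_sub_antiperiodic hF (hw1 (p, z)) (hw0 (p, z))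
      ((hinj p).mono fun q hq => lt_of_le_of_lt hq (hwτ (p, z)))
      (k := fun θ => k (p, ⟨z + θ, add_real_im_pos z θ⟩))
      (by
        refine hkc.comp (continuous_const.prodMk ?_)
        rw [UpperHalfPlane.isEmbedding_coe.continuous_iff]
        change Continuous fun θ : ℝ => (z : ℂ) + θ
        fun_prop)
      (fun θ => by
        rw [hk]
        simp only [hE]
        congr 3
        simp only [hw]
        rw [mul_add, Complex.exp_add, mul_comm Complex.I (θ : ℂ), mul_assoc])
    have hz' : z' = ⟨z + ((2 * Real.pi : ℝ) : ℂ), add_real_im_pos z _⟩ := by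
      apply UpperHalfPlane.ext
      rw [hz]
      push_cast
      rfl
    have hz0 : z = ⟨z + ((0 : ℝ) : ℂ), add_real_im_pos z _⟩ := by
      apply UpperHalfPlane.ext
      push_cast
      exact (add_zero _).symm
    rw [hz']
    refine this.trans ?_
    rw [← hz0]
  set H : ℍ × ℍ → ℂ := fun x =>
    k x / ((√(τ x.1) : ℝ) * Complex.exp (Complex.I * x.2 / 2)) with hH
  have hHc : Continuous H := by
    have := UpperHalfPlane.continuous_coe
    refine hkc.div (by fun_prop) fun x => mul_ne_zero
      (Complex.ofReal_ne_zero.2 (Real.sqrt_pos.2 (h0 _)).ne') (Complex.exp_ne_zero _)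
  have hHsq : ∀ x, H x ^ 2 * w x = E x := by
    intro x
    have a : ((√(τ x.1) : ℝ) : ℂ) ^ 2 = τ x.1 := by
      rw [← Complex.ofReal_pow, Real.sq_sqrt (h0 _).le]
    have b : Complex.exp (Complex.I * x.2 / 2) ^ 2 = Complex.exp (Complex.I * x.2) := by
      rw [← Complex.exp_nat_mul]; congr 1; push_cast; ring
    simp only [hH]
    rw [div_pow, mul_pow, a, b, hk, div_mul_cancel₀ _ (hw0 x)]
  have hper : ∀ (p z z' : ℍ), (z' : ℂ) = z + 2 * Real.pi → H (p, z') = H (p, z) := by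
    intro p z z' hz
    simp only [hH]
    rw [hanti p z z' hz, hz]
    have : Complex.exp (Complex.I * (z + 2 * Real.pi) / 2)
        = - Complex.exp (Complex.I * z / 2) := by
      rw [show Complex.I * (z + 2 * Real.pi) / 2 = Complex.I * z / 2 + Real.pi * Complex.I by ring,
        Complex.exp_add, Complex.exp_pi_mul_I]; ring
    rw [this, mul_neg, neg_div_neg_eq]
  have hpern : ∀ (n : ℕ) (p z z' : ℍ), (z' : ℂ) = z + n * (2 * Real.pi) →
      H (p, z') = H (p, z) := by
    intro n
    induction n with
    | zero =>
      intro p z z' hz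
      rw [show z' = z from UpperHalfPlane.ext (by simpa using hz)]
    | succ n ih =>
      intro p z z' hz
      rw [← ih p z ⟨z + ((n * (2 * Real.pi) : ℝ) : ℂ), add_real_im_pos z _⟩ (by push_cast; rfl)]
      refine hper _ _ _ ?_
      rw [hz]
      push_cast
      ring
  have hexp : ∀ (p z z' : ℍ), Complex.exp (Complex.I * z) = Complex.exp (Complex.I * z') →
      H (p, z) = H (p, z') := by
    intro p z z' h
    obtain ⟨n, hn⟩ := Complex.exp_eq_exp_iff_exists_int.1 h
    have hn' : (z : ℂ) = z' + n * (2 * Real.pi) := by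
      apply mul_left_cancel₀ Complex.I_ne_zero
      rw [hn]; ring
    obtain ⟨m, rfl | rfl⟩ := n.eq_nat_or_neg
    · exact hpern m p z' z (by simpa using hn')
    · refine (hpern m p z z' ?_).symm
      rw [hn']; push_cast; ring
  set ζ : ℍ × ℍ → ℂ := fun x => discCoord x.1 x.2 / τ x.1 with hζ
  have hζc : Continuous ζ := continuous_discCoord.div (by fun_prop)
    fun x => Complex.ofReal_ne_zero.2 (h0 _).ne'
  have hζ0 : ∀ x ∈ nearPairs τ, ζ x ≠ 0 := fun x hx =>
    div_ne_zero (norm_pos_iff.1 hx.1) (Complex.ofReal_ne_zero.2 (h0 _).ne')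
  have hζ1 : ∀ x ∈ nearPairs τ, ‖ζ x‖ < 1 := fun x hx => by
    simp only [hζ]
    rw [norm_div, Complex.norm_real, Real.norm_of_nonneg (h0 _).le, div_lt_one (h0 _)]
    exact hx.2
  have him : ∀ y : ℂ, y ≠ 0 → ‖y‖ < 1 → ∀ t : ℝ,
      0 < (-Complex.I * (Complex.log y + t * Complex.I)).im := by
    intro y hy hy1 t
    have := Real.log_neg (norm_pos_iff.2 hy) hy1
    simpa [Complex.log_re] using this
  have hval : ∀ y : ℂ, y ≠ 0 → ‖y‖ < 1 → ∀ t : ℝ,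
      Complex.exp (Complex.I * (ofComplex (-Complex.I * (Complex.log y + t * Complex.I)) : ℂ))
        = y * Complex.exp (t * Complex.I) := by
    intro y hy hy1 t
    rw [ofComplex_apply_of_im_pos (him y hy hy1 t)]
    change Complex.exp (Complex.I * (-Complex.I * (Complex.log y + t * Complex.I))) = _
    rw [← mul_assoc, mul_neg, Complex.I_mul_I, neg_neg, one_mul, Complex.exp_add,
      Complex.exp_log hy]
  have hcont : ∀ (t : ℝ) (y : ℍ × ℍ → ℂ), Continuous y → ∀ x, y x ∈ Complex.slitPlane →
      ‖y x‖ < 1 → ContinuousAt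
        (fun x => H (x.1, ofComplex (-Complex.I * (Complex.log (y x) + t * Complex.I)))) x := by
    intro t y hy x hx hx1
    refine hHc.continuousAt.comp (continuous_fst.continuousAt.prodMk ?_)
    have hpos := him (y x) (Complex.slitPlane_ne_zero hx) hx1 t
    have hof : ContinuousAt (ofComplex : ℂ → ℍ)
        (-Complex.I * (Complex.log (y x) + t * Complex.I)) := by
      rw [UpperHalfPlane.isEmbedding_coe.continuousAt_iff]
      refine continuousAt_id.congr ?_
      filter_upwards [(isOpen_lt continuous_const Complex.continuous_im).mem_nhds hpos] with v hv
      exact (congrArg UpperHalfPlane.coe (ofComplex_apply_of_im_pos hv)).symm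
    refine ContinuousAt.comp (f := fun x => -Complex.I * (Complex.log (y x) + t * Complex.I)) hof ?_
    exact continuousAt_const.mul ((hy.continuousAt.clog hx).add continuousAt_const)
  refine ⟨fun x => H (x.1, ofComplex (-Complex.I * (Complex.log (ζ x) + (0 : ℝ) * Complex.I))),
    ?_, ?_⟩
  · intro x hx
    -- On the cut of the principal logarithm, log(-ζ) + πi is used instead. It has the same
    -- exponential, and `H` depends on z only through exp(iz).
    by_cases hs : ζ x ∈ Complex.slitPlane
    · exact (hcont 0 ζ hζc x hs (hζ1 x hx)).continuousWithinAt
    · have hs' : -ζ x ∈ Complex.slitPlane := by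
        rw [Complex.mem_slitPlane_iff, not_or, not_lt, not_not] at hs
        rw [Complex.mem_slitPlane_iff]
        left
        have hne : (ζ x).re ≠ 0 := fun h => hζ0 x hx (Complex.ext h hs.2)
        simpa using lt_of_le_of_ne hs.1 hne
      refine (hcont Real.pi (fun x => -ζ x) hζc.neg x hs'
        (by rw [norm_neg]; exact hζ1 x hx)).continuousWithinAt.congr ?_ ?_
      · intro y hy
        apply hexp
        rw [hval _ (hζ0 y hy) (hζ1 y hy), hval _ (neg_ne_zero.2 (hζ0 y hy))
          (by rw [norm_neg]; exact hζ1 y hy), Complex.exp_pi_mul_I]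
        simp
      · apply hexp
        rw [hval _ (hζ0 x hx) (hζ1 x hx), hval _ (neg_ne_zero.2 (hζ0 x hx))
          (by rw [norm_neg]; exact hζ1 x hx), Complex.exp_pi_mul_I]
        simp
  · intro x hx
    set z : ℍ := ofComplex (-Complex.I * (Complex.log (ζ x) + (0 : ℝ) * Complex.I)) with hz
    have hwz : w (x.1, z) = discCoord x.1 x.2 := by
      have := hval _ (hζ0 x hx) (hζ1 x hx) 0
      rw [← hz] at this
      simp only [hw]
      rw [this]
      simp only [hζ]
      rw [Complex.ofReal_zero, zero_mul, Complex.exp_zero, mul_one,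
        mul_div_cancel₀ _ (Complex.ofReal_ne_zero.2 (h0 _).ne')]
    have := hHsq (x.1, z)
    rw [hwz] at this
    refine this.trans ?_
    simp only [hE]
    rw [hwz, discPoint_discCoord]

theorem exists_exp_I_mul_eq {ζ : ℂ} (h0 : ζ ≠ 0) (h1 : ‖ζ‖ < 1) :
    ∃ z : ℍ, Complex.exp (Complex.I * z) = ζ := by
  have := Real.log_neg (norm_pos_iff.2 h0) h1
  refine ⟨⟨-Complex.I * Complex.log ζ, by simpa [Complex.log_re] using this⟩, ?_⟩
  change Complex.exp (Complex.I * (-Complex.I * Complex.log ζ)) = _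
  rw [← mul_assoc, mul_neg, Complex.I_mul_I, neg_neg, one_mul, Complex.exp_log h0]

/-- The set is the continuous image of ℍ × ℍ under the universal cover parametrisation of the
punctured discs. -/
theorem isConnected_nearPairs {τ : ℍ → ℝ} (hτ : Continuous τ)
    (h0 : ∀ p, 0 < τ p) (h1 : ∀ p, τ p ≤ 1) : IsConnected (nearPairs τ) := by
  have hlt : ∀ x : ℍ × ℍ, ‖(τ x.1 : ℂ) * Complex.exp (Complex.I * x.2)‖ < 1 := fun x =>
    (norm_ofReal_mul_exp (h0 _) _).trans_le (h1 _)
  have hc : Continuous fun x : ℍ × ℍ =>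
      (x.1, discPoint x.1 ((τ x.1 : ℂ) * Complex.exp (Complex.I * x.2))) := by
    have := UpperHalfPlane.continuous_coe
    exact continuous_fst.prodMk (continuous_discPoint continuous_fst (by fun_prop) hlt)
  convert isConnected_range hc
  ext x
  constructor
  · intro hx
    have hne : (τ x.1 : ℂ) ≠ 0 := Complex.ofReal_ne_zero.2 (h0 _).ne'
    obtain ⟨z, hz⟩ := exists_exp_I_mul_eq (ζ := discCoord x.1 x.2 / τ x.1)
      (div_ne_zero (norm_pos_iff.1 hx.1) hne) (by
        rw [norm_div, Complex.norm_real, Real.norm_of_nonneg (h0 _).le, div_lt_one (h0 _)]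
        exact hx.2)
    refine ⟨(x.1, z), Prod.ext rfl ?_⟩
    simp only [hz]
    rw [mul_div_cancel₀ _ hne, discPoint_discCoord]
  · rintro ⟨y, rfl⟩
    simp only [nearPairs, Set.mem_ofPred]
    rw [discCoord_discPoint _ (hlt y)]
    exact ⟨norm_pos_iff.2 (mul_ne_zero (Complex.ofReal_ne_zero.2 (h0 _).ne')
      (Complex.exp_ne_zero _)), norm_ofReal_mul_exp (h0 _) _⟩

/-! ### Spin lifts. -/

/-- The unitary part of the automorphy factor. -/
noncomputable def unitFactor (g : SpecialLinearGroup (Fin 2) ℝ) (p : ℍ) : ℂ :=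
  autFactor g p / (‖autFactor g p‖ : ℝ)

theorem norm_autFactor_ne_zero (g : SpecialLinearGroup (Fin 2) ℝ) (p : ℍ) :
    ((‖autFactor g p‖ : ℝ) : ℂ) ≠ 0 :=
  Complex.ofReal_ne_zero.2 (norm_ne_zero_iff.2 (autFactor_ne_zero g p))

theorem norm_unitFactor (g : SpecialLinearGroup (Fin 2) ℝ) (p : ℍ) : ‖unitFactor g p‖ = 1 := by
  rw [unitFactor, norm_div, Complex.norm_real, norm_norm,
    div_self (norm_ne_zero_iff.2 (autFactor_ne_zero g p))]

theorem unitFactor_ne_zero (g : SpecialLinearGroup (Fin 2) ℝ) (p : ℍ) : unitFactor g p ≠ 0 :=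
  norm_ne_zero_iff.1 (by rw [norm_unitFactor]; exact one_ne_zero)

theorem unitFactor_mul_conj (g : SpecialLinearGroup (Fin 2) ℝ) (p : ℍ) :
    unitFactor g p * conj (unitFactor g p) = 1 := by
  rw [Complex.mul_conj, Complex.normSq_eq_norm_sq, norm_unitFactor]; simp

theorem unitFactor_mul (g h : SpecialLinearGroup (Fin 2) ℝ) (p : ℍ) :
    unitFactor (g * h) p = unitFactor g (h • p) * unitFactor h p := by
  simp only [unitFactor, autFactor_mul, norm_mul, Complex.ofReal_mul, mul_div_mul_comm]

theorem unitFactor_neg (g : SpecialLinearGroup (Fin 2) ℝ) (p : ℍ) :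
    unitFactor (-g) p = - unitFactor g p := by
  simp only [unitFactor, autFactor_neg, norm_neg, neg_div]

theorem continuous_unitFactor (g : SpecialLinearGroup (Fin 2) ℝ) : Continuous (unitFactor g) := by
  have := continuous_autFactor g
  exact this.div (by fun_prop) (norm_autFactor_ne_zero g)

theorem discCoord_smul_eq (g : SpecialLinearGroup (Fin 2) ℝ) (p q : ℍ) :
    discCoord (g • p) (g • q) = discCoord p q * conj (unitFactor g p) ^ 2 := by
  rw [discCoord_smul]
  congr 1
  have h1 := autFactor_ne_zero g p
  have h2 := norm_autFactor_ne_zero g p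
  have h3 : conj (autFactor g p) * autFactor g p = ((‖autFactor g p‖ : ℝ) : ℂ) ^ 2 := by
    rw [mul_comm, Complex.mul_conj, Complex.normSq_eq_norm_sq]; push_cast; rfl
  simp only [unitFactor, map_div₀, Complex.conj_ofReal]
  rw [div_pow, ← h3]
  have h4 : conj (autFactor g p) ≠ 0 := by simpa using h1
  field_simp

theorem smul_mem_nearPairs {τ : ℍ → ℝ} {g : SpecialLinearGroup (Fin 2) ℝ}
    (hτ : ∀ p, τ (g • p) = τ p) {x : ℍ × ℍ} (hx : x ∈ nearPairs τ) : g • x ∈ nearPairs τ := by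
  have : ‖discCoord (g • x.1) (g • x.2)‖ = ‖discCoord x.1 x.2‖ := by
    rw [discCoord_smul_eq, norm_mul, norm_pow, Complex.norm_conj, norm_unitFactor]; simp
  simp only [nearPairs, Set.mem_ofPred, Prod.smul_fst, Prod.smul_snd, this, hτ]
  exact hx

/-- `g` acts compatibly on the spinorial root `h`. -/
def IsSpinLift (τ : ℍ → ℝ) (h : ℍ × ℍ → ℂ) (g : SpecialLinearGroup (Fin 2) ℝ) : Prop :=
  ∀ x ∈ nearPairs τ, h (g • x) = unitFactor g x.1 * h x

theorem IsSpinLift.mul {τ : ℍ → ℝ} {h : ℍ × ℍ → ℂ} {g g' : SpecialLinearGroup (Fin 2) ℝ}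
    (hg : IsSpinLift τ h g) (hg' : IsSpinLift τ h g') (hτ : ∀ p, τ (g' • p) = τ p) :
    IsSpinLift τ h (g * g') := by
  intro x hx
  rw [mul_smul, hg _ (smul_mem_nearPairs hτ hx), hg' x hx, unitFactor_mul, mul_assoc]
  rfl

theorem IsSpinLift.inv {τ : ℍ → ℝ} {h : ℍ × ℍ → ℂ} {g : SpecialLinearGroup (Fin 2) ℝ}
    (hg : IsSpinLift τ h g) (hτ : ∀ p, τ (g • p) = τ p) :
    IsSpinLift τ h g⁻¹ := by
  intro x hx
  have hτ' : ∀ p, τ (g⁻¹ • p) = τ p := fun p => by rw [← hτ, smul_inv_smul]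
  have h1 := hg _ (smul_mem_nearPairs hτ' hx)
  have h2 := unitFactor_mul g g⁻¹ x.1
  rw [smul_inv_smul] at h1
  have h3 : unitFactor 1 x.1 = 1 := by simp [unitFactor, autFactor_one]
  rw [mul_inv_cancel, h3] at h2
  rw [h1, Prod.smul_fst, ← mul_assoc, mul_comm (unitFactor g⁻¹ x.1), ← h2, one_mul]

/-- Invariance of F and the transformation law of `discCoord` show that h(g•x) and `unitFactor g` ·
h(x) have equal squares. Connectedness leaves one global sign, which is absorbed by passing to -g, a
matrix with the same action on ℍ. -/
theorem isSpinLift_or_neg {F : ℍ → ℂ} {τ : ℍ → ℝ} (hτ : Continuous τ)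
    (h0 : ∀ p, 0 < τ p) (h1 : ∀ p, τ p ≤ 1)
    (hinj : ∀ p, Set.InjOn F {q | ‖discCoord p q‖ < τ p})
    {h : ℍ × ℍ → ℂ} (hh : ContinuousOn h (nearPairs τ))
    (hsq : ∀ x ∈ nearPairs τ, h x ^ 2 * discCoord x.1 x.2 = F x.2 - F x.1)
    {g : SpecialLinearGroup (Fin 2) ℝ} (hF : ∀ p, F (g • p) = F p) (hg : ∀ p, τ (g • p) = τ p) :
    IsSpinLift τ h g ∨ IsSpinLift τ h (-g) := by
  have hconn := isConnected_nearPairs hτ h0 h1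
  have : ConnectedSpace (nearPairs τ) := Subtype.connectedSpace hconn
  have hh0 : ∀ x ∈ nearPairs τ, h x ≠ 0 := by
    intro x hx hx0
    have e := hsq x hx
    rw [hx0] at e
    have e' : F x.1 = F x.2 := by
      have : F x.2 - F x.1 = 0 := by rw [← e]; ring
      exact (sub_eq_zero.1 this).symm
    have := hinj x.1 (by rw [Set.mem_ofPred, discCoord_eq_zero.2 rfl, norm_zero]; exact h0 _)
      (by exact hx.2) e'
    exact norm_pos_iff.1 hx.1 (discCoord_eq_zero.2 this)
  have hdist : ∀ x ∈ nearPairs τ, discCoord x.1 x.2 ≠ 0 := fun x hx => norm_pos_iff.1 hx.1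
  have hgc : Continuous fun x : ℍ × ℍ => g • x := by fun_prop
  obtain ⟨ε, hε, hr⟩ := exists_const_ratio (X := nearPairs τ) (c := 1)
    (u := fun x => h (g • x.1)) (v := fun x => unitFactor g x.1.1 * h x.1)
    (hh.comp_continuous (hgc.comp continuous_subtype_val) fun x => smul_mem_nearPairs hg x.2)
    (((continuous_unitFactor g).comp (continuous_fst.comp continuous_subtype_val)).mul
      (hh.comp_continuous continuous_subtype_val fun x => x.2))
    (fun x => mul_ne_zero (unitFactor_ne_zero _ _) (hh0 _ x.2))
    (fun x => by
      have e1 := hsq _ (smul_mem_nearPairs hg x.2)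
      have e2 := hsq _ x.2
      rw [Prod.smul_fst, Prod.smul_snd, hF, hF, ← e2, discCoord_smul_eq, mul_comm (discCoord _ _),
        ← mul_assoc] at e1
      have e3 := mul_right_cancel₀ (hdist _ x.2) e1
      rw [mul_pow, ← e3, one_mul]
      have := unitFactor_mul_conj g x.1.1
      linear_combination (- h (g • x.1) ^ 2 *
        (unitFactor g x.1.1 * conj (unitFactor g x.1.1) + 1)) * this)
  rcases sq_eq_sq_iff_eq_or_eq_neg.1 (hε.trans (one_pow 2).symm) with rfl | rfl
  · left
    intro x hx
    simpa using hr ⟨x, hx⟩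
  · right
    intro x hx
    have e : (-g) • x = g • x := by
      refine Prod.ext ?_ ?_ <;>
      · simp only [Prod.smul_fst, Prod.smul_snd]
        apply UpperHalfPlane.ext
        rw [UpperHalfPlane.coe_specialLinearGroup_apply, UpperHalfPlane.coe_specialLinearGroup_apply]
        simp only [SpecialLinearGroup.coe_neg, Matrix.neg_apply, map_neg, Complex.ofReal_neg]
        rw [← neg_div_neg_eq]
        congr 1 <;> ring
    rw [e, unitFactor_neg]
    simpa using hr ⟨x, hx⟩

/-! ### Fixed points, horocycles and the sign of the trace. -/

theorem four_le_trace_sq {g : SpecialLinearGroup (Fin 2) ℝ} (hfix : ∀ p : ℍ, g • p ≠ p) :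
    4 ≤ (g.1 0 0 + g.1 1 1) ^ 2 := by
  by_contra! hlt
  have hd := det_expand g
  have hc : g.1 1 0 ≠ 0 := by
    intro hc
    rw [hc] at hd
    nlinarith [sq_nonneg (g.1 0 0 - g.1 1 1)]
  set a := g.1 0 0 with ha
  set b := g.1 0 1 with hb
  set c := g.1 1 0 with hc'
  set d := g.1 1 1 with hd'
  have hs : 0 < √(4 - (a + d) ^ 2) := Real.sqrt_pos.2 (by linarith)
  have hs2 : √(4 - (a + d) ^ 2) ^ 2 = 4 - (a + d) ^ 2 := Real.sq_sqrt (by linarith)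
  set s := √(4 - (a + d) ^ 2)
  have hc2 : |c| ^ 2 = c ^ 2 := sq_abs c
  have hcpos : 0 < |c| := abs_pos.2 hc
  -- This is the fixed point of an elliptic element: the root in ℍ of cp² + (d - a)p - b = 0.
  set p : ℍ := ⟨⟨(a - d) / (2 * c), s / (2 * |c|)⟩, by positivity⟩ with hp
  apply hfix p
  apply UpperHalfPlane.ext
  apply mul_right_cancel₀ (autFactor_ne_zero g p)
  rw [coe_smul_mul]
  simp only [autFactor]
  rw [← ha, ← hb, ← hc', ← hd']
  have hpc : (p : ℂ) = ⟨(a - d) / (2 * c), s / (2 * |c|)⟩ := rfl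
  have hy2 : (s / (2 * |c|)) ^ 2 = (4 - (a + d) ^ 2) / (4 * c ^ 2) := by
    rw [div_pow, mul_pow, hs2, hc2]; norm_num
  rw [hpc]
  apply Complex.ext
  · simp
    have : (s / (2 * |c|)) * (c * (s / (2 * |c|))) = c * ((4 - (a + d) ^ 2) / (4 * c ^ 2)) := by
      rw [← hy2]; ring
    rw [this]
    field_simp
    linear_combination (-16) * hd
  · simp
    field_simp
    ring

/-- A unimodular matrix of trace at least two has a positive eigenvalue which is at most one. -/
theorem exists_eigenvector {g : SpecialLinearGroup (Fin 2) ℝ} (h2 : 2 ≤ g.1 0 0 + g.1 1 1) :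
    ∃ ν e₁ e₂ : ℝ, 0 < ν ∧ ν ≤ 1 ∧ (e₁ ≠ 0 ∨ e₂ ≠ 0) ∧
      g.1 0 0 * e₁ + g.1 0 1 * e₂ = ν * e₁ ∧ g.1 1 0 * e₁ + g.1 1 1 * e₂ = ν * e₂ := by
  have hd := det_expand g
  set t := g.1 0 0 + g.1 1 1 with ht
  have hs2 : √(t ^ 2 - 4) ^ 2 = t ^ 2 - 4 := Real.sq_sqrt (by nlinarith)
  have hs0 := Real.sqrt_nonneg (t ^ 2 - 4)
  set s := √(t ^ 2 - 4)
  have hdet : (g.1 - Matrix.scalar (Fin 2) ((t - s) / 2)).det = 0 := by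
    rw [det_fin_two]
    simp
    nlinarith
  obtain ⟨v, hv, hv2⟩ := Matrix.exists_mulVec_eq_zero_iff.2 hdet
  have e0 := congrFun hv2 0
  have e1 := congrFun hv2 1
  simp [mulVec, dotProduct, Fin.sum_univ_two] at e0 e1
  refine ⟨(t - s) / 2, v 0, v 1, by nlinarith, by nlinarith, ?_, by linarith, by linarith⟩
  by_contra! hcon
  apply hv
  ext i
  fin_cases i
  · exact hcon.1
  · exact hcon.2

/-- If the geodesic ray from `p` through `q` ends at the real point `e₁/e₂`, then `q` is higher
than `p` with respect to the horocycles based there. -/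
theorem height_lt {p q : ℍ} {e₁ e₂ r : ℝ} (he : e₁ ≠ 0 ∨ e₂ ≠ 0) (hr : 0 < r)
    (h : discCoord p q * conj ((e₁ : ℂ) - e₂ * p) = r * ((e₁ : ℂ) - e₂ * p)) :
    p.im * Complex.normSq ((e₁ : ℂ) - e₂ * q) < q.im * Complex.normSq ((e₁ : ℂ) - e₂ * p) := by
  set E : ℂ := (e₁ : ℂ) - e₂ * p with hE
  have hE0 : E ≠ 0 := by
    intro h0
    have h1 := congrArg Complex.im h0
    have h2 := congrArg Complex.re h0
    have hp := p.im_pos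
    simp [hE] at h1 h2
    rcases h1 with h1 | h1
    · rw [h1] at h2; simp at h2; rcases he with he | he <;> contradiction
    · exact hp.ne' h1
  have hr1 : r < 1 := by
    have h1 := congrArg norm h
    rw [norm_mul, norm_mul, Complex.norm_conj, Complex.norm_real, Real.norm_of_nonneg hr.le] at h1
    rw [← mul_right_cancel₀ (norm_ne_zero_iff.2 hE0) h1]
    exact norm_discCoord_lt_one p q
  have hq : ((q : ℂ) - p) * conj E = r * E * (q - conj (p : ℂ)) := by
    have := sub_conj_ne_zero p q
    rw [← h, discCoord]
    field_simp
  set W : ℂ := conj E - r * E with hW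
  have hqW : (q : ℂ) * W = p * conj E - r * conj (p : ℂ) * E := by
    rw [hW]; linear_combination hq
  have hEW : ((e₁ : ℂ) - e₂ * q) * W = Complex.normSq E * (1 - r) := by
    have hc : conj E = (e₁ : ℂ) - e₂ * conj (p : ℂ) := by simp [hE]
    rw [← Complex.mul_conj]
    calc _ = e₁ * W - e₂ * (q * W) := by ring
      _ = _ := by rw [hqW, hW, hc, hE]; ring
  have hnE : 0 < Complex.normSq E := Complex.normSq_pos.2 hE0
  have hW0 : W ≠ 0 := by
    intro h0
    rw [h0, mul_zero] at hEW
    have h3 : (1 : ℂ) - r ≠ 0 := by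
      intro h4
      have := Complex.ofReal_injective (sub_eq_zero.1 h4)
      linarith
    exact mul_ne_zero (Complex.ofReal_ne_zero.2 hnE.ne') h3 hEW.symm
  have hZ : 0 < Complex.normSq W := Complex.normSq_pos.2 hW0
  have hZq : Complex.normSq ((e₁ : ℂ) - e₂ * q) * Complex.normSq W
      = Complex.normSq E ^ 2 * (1 - r) ^ 2 := by
    rw [← map_mul, hEW, map_mul, Complex.normSq_ofReal]
    have : ((1 : ℂ) - r) = ((1 - r : ℝ) : ℂ) := by push_cast; rfl
    rw [this, Complex.normSq_ofReal]
    ring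
  have hIm : q.im * Complex.normSq W = p.im * Complex.normSq E * (1 - r ^ 2) := by
    have h1 : (q : ℂ) * (Complex.normSq W : ℝ)
        = (p * conj E - r * conj (p : ℂ) * E) * conj W := by
      rw [← hqW, ← Complex.mul_conj]; ring
    have h2 := congrArg Complex.im h1
    rw [Complex.im_mul_ofReal] at h2
    refine h2.trans ?_
    simp [hW, Complex.normSq_apply]
    ring
  have hy := p.im_pos
  -- The heights Im/|e₁ - e₂·|² of q and p have ratio (1 - r²)/(1 - r)² = (1 + r)/(1 - r), which
  -- exceeds 1.
  have key : p.im * Complex.normSq ((e₁ : ℂ) - e₂ * q) * Complex.normSq W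
      < q.im * Complex.normSq E * Complex.normSq W := by
    have e1 : p.im * Complex.normSq ((e₁ : ℂ) - e₂ * q) * Complex.normSq W
        = (p.im * Complex.normSq E ^ 2) * (1 - r) ^ 2 := by rw [mul_assoc, hZq]; ring
    have e2 : q.im * Complex.normSq E * Complex.normSq W
        = (p.im * Complex.normSq E ^ 2) * (1 - r ^ 2) := by
      rw [mul_right_comm, hIm]; ring
    rw [e1, e2]
    apply mul_lt_mul_of_pos_left _ (by positivity)
    nlinarith
  exact lt_of_mul_lt_mul_right key hZ.le

/-- The spin lift of the holonomy of an embedded round circle has negative trace. -/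
theorem IsSpinLift.trace_neg {F : ℍ → ℂ} {τ : ℍ → ℝ} (hτ : Continuous τ)
    (h0 : ∀ p, 0 < τ p)
    {h : ℍ × ℍ → ℂ} (hh : ContinuousOn h (nearPairs τ))
    (hsq : ∀ x ∈ nearPairs τ, h x ^ 2 * discCoord x.1 x.2 = F x.2 - F x.1)
    {g : SpecialLinearGroup (Fin 2) ℝ} (hg : IsSpinLift τ h g) (hfix : ∀ p : ℍ, g • p ≠ p)
    {c : ℝ → ℍ} (hc : Continuous c) (hper : ∀ t, c (t + 1) = g • c t) {z₀ ω : ℂ} (hω : ω ≠ 0)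
    (hFc : ∀ t : ℝ, F (c t) = z₀ + ω * Complex.exp (2 * Real.pi * t * Complex.I)) :
    g.1 0 0 + g.1 1 1 < 0 := by
  have hexp1 : ∀ s : ℝ, 0 < s → s < 1 → Complex.exp (2 * Real.pi * s * Complex.I) ≠ 1 := by
    intro s hs0 hs1 he
    obtain ⟨n, hn⟩ := Complex.exp_eq_one_iff.1 he
    have hpi : (2 * Real.pi * Complex.I : ℂ) ≠ 0 := Complex.two_pi_I_ne_zero
    have hsn : (s : ℂ) = n := by
      apply mul_right_cancel₀ hpi
      rw [← hn]; ring
    have hsn' : s = n := by exact_mod_cast hsn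
    rw [hsn'] at hs0 hs1
    have h1 : 0 < n := by exact_mod_cast hs0
    have h2 : n < 1 := by exact_mod_cast hs1
    omega
  have hdiff : ∀ t s : ℝ, F (c (t + s)) - F (c t) =
      ω * (Complex.exp (2 * Real.pi * s * Complex.I) - 1)
        * Complex.exp (2 * Real.pi * t * Complex.I) := by
    intro t s
    rw [hFc, hFc]
    push_cast
    rw [show (2 * Real.pi * (t + s) * Complex.I : ℂ) = 2 * Real.pi * s * Complex.I
      + 2 * Real.pi * t * Complex.I by ring, Complex.exp_add]
    ring
  have hne : ∀ t s : ℝ, 0 < s → s ≤ 1 → discCoord (c t) (c (t + s)) ≠ 0 := by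
    intro t s hs0 hs1 heq
    have heq := discCoord_eq_zero.1 heq
    rcases hs1.lt_or_eq with hs1 | rfl
    · have h1 := hdiff t s
      rw [← heq, sub_self] at h1
      exact mul_ne_zero (mul_ne_zero hω (sub_ne_zero.2 (hexp1 s hs0 hs1)))
        (Complex.exp_ne_zero _) h1.symm
    · rw [hper] at heq
      exact hfix _ heq.symm
  -- The chord from c t to c (t + s u) has step in (0, 1], so the parameters (t, u) fill a plane.
  -- The value u = 0 gives the chord to g • c t, and u = log a gives a short one.
  set s : ℝ → ℝ := fun u => min 1 (Real.exp u) with hs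
  have hsc : Continuous s := by fun_prop
  have hs0 : ∀ u, 0 < s u := fun u => lt_min one_pos (Real.exp_pos u)
  have hs1 : ∀ u, s u ≤ 1 := fun u => min_le_left _ _
  obtain ⟨k, hkc, hk⟩ := exists_sqrt (X := ℝ × ℝ)
    (f := fun x => discCoord (c x.1) (c (x.1 + s x.2)))
    (continuous_discCoord.comp (Continuous.prodMk (by fun_prop) (by fun_prop)))
    (fun x => hne _ _ (hs0 _) (hs1 _))
  have hk0 : ∀ x, k x ≠ 0 := fun x hx => hne x.1 _ (hs0 x.2) (hs1 _) (by rw [← hk x, hx]; simp)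
  have hstar : Continuous fun z : ℂ => conj z := Complex.continuous_conj
  have hUc : Continuous fun x : ℝ × ℝ => conj (unitFactor g (c x.1)) :=
    hstar.comp ((continuous_unitFactor g).comp (hc.comp continuous_fst))
  -- The sign σ is the same for all chord lengths. It is computed on short chords, where h is
  -- defined, and used on the full one.
  obtain ⟨σ, -, hσ⟩ := exists_const_ratio (X := ℝ × ℝ) (c := 1)
    (u := fun x => k (x.1 + 1, x.2)) (v := fun x => conj (unitFactor g (c x.1)) * k x)
    (by fun_prop) (by fun_prop)
    (fun x => mul_ne_zero (by simpa using unitFactor_ne_zero g _) (hk0 x))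
    (fun x => by
      rw [hk, mul_pow, hk, one_mul]
      simp only
      rw [hper, add_right_comm, hper, discCoord_smul_eq, mul_comm])
  have hnear : ∀ᶠ a in 𝓝 (0 : ℝ), ∀ t ∈ Set.Icc (0 : ℝ) 1,
      ‖discCoord (c t) (c (t + a))‖ < τ (c t) := by
    refine isCompact_Icc.eventually_forall_of_forall_eventually fun t _ => ?_
    have h1 : Continuous fun z : ℝ × ℝ => ‖discCoord (c z.2) (c (z.2 + z.1))‖ :=
      (continuous_discCoord.comp (Continuous.prodMk (by fun_prop) (by fun_prop))).norm
    have h2 : Continuous fun z : ℝ × ℝ => τ (c z.2) := by fun_prop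
    refine (isOpen_lt h1 h2).mem_nhds ?_
    rw [Set.mem_ofPred]
    simp only [add_zero]
    rw [discCoord_eq_zero.2 rfl, norm_zero]
    exact h0 _
  obtain ⟨a, ha, ha0, ha1⟩ := ((hnear.filter_mono nhdsWithin_le_nhds).and
    (Ioo_mem_nhdsGT (zero_lt_one' ℝ))).exists
  have hsa : s (Real.log a) = a := by
    simp only [hs, Real.exp_log ha0]
    exact min_eq_right ha1.le
  have hmem : ∀ t : Set.Icc (0 : ℝ) 1, (c t, c (t + a)) ∈ nearPairs τ := fun t =>
    ⟨norm_pos_iff.2 (hne _ _ ha0 ha1.le), ha t t.2⟩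
  obtain ⟨ε, -, hε⟩ := exists_const_ratio (X := Set.Icc (0 : ℝ) 1)
    (c := ω * (Complex.exp (2 * Real.pi * a * Complex.I) - 1))
    (u := fun t => h (c t, c (t + a)) * k (t, Real.log a))
    (v := fun t => Complex.exp (Real.pi * (t : ℝ) * Complex.I))
    ((hh.comp_continuous (Continuous.prodMk (by fun_prop) (by fun_prop)) hmem).mul
      (by fun_prop)) (by fun_prop) (fun x => Complex.exp_ne_zero _)
    (fun t => by
      rw [mul_pow, hk]
      simp only
      rw [hsa, hsq _ (hmem t), hdiff, ← Complex.exp_nat_mul]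
      congr 2
      push_cast
      ring)
  -- On short chords h·k is a constant times exp(πit), which changes sign over a period. The unitary
  -- factors of h and k are conjugate and cancel, so the sign must come from σ.
  have hσ1 : σ = -1 := by
    have e0 := hε ⟨0, by simp⟩
    have e1 := hε ⟨1, by simp⟩
    simp only [Complex.ofReal_zero, mul_zero, zero_mul, Complex.exp_zero, mul_one,
      Complex.ofReal_one, Complex.exp_pi_mul_I] at e0 e1
    have m0 := hmem ⟨0, by simp⟩
    have hu0 : h (c 0, c (0 + a)) ≠ 0 := by
      intro hz
      have h1 := hsq _ m0
      simp only [hz] at h1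
      rw [hdiff] at h1
      exact mul_ne_zero (mul_ne_zero hω (sub_ne_zero.2 (hexp1 a ha0 ha1)))
        (Complex.exp_ne_zero _) (by rw [← h1]; ring)
    have h2 := hg _ m0
    rw [Prod.smul_mk, ← hper, ← hper] at h2
    have h3 := hσ (0, Real.log a)
    simp only at h3 h2
    have e2 : h (c (0 + 1), c (0 + a + 1)) * k (0 + 1, Real.log a) = ε * -1 := by
      rw [zero_add (1 : ℝ), show 0 + a + 1 = 1 + a by ring]; exact e1
    rw [h2, h3] at e2
    have h4 := unitFactor_mul_conj g (c 0)
    apply mul_right_cancel₀ (mul_ne_zero hu0 (hk0 (0, Real.log a)))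
    linear_combination e2 + e0 - σ * h (c 0, c (0 + a)) * k (0, Real.log a) * h4
  by_contra! htr
  have h4 := four_le_trace_sq hfix
  obtain ⟨ν, e₁, e₂, hν0, hν1, he, hv0, hv1⟩ := exists_eigenvector (g := g) (by nlinarith)
  -- E(p) / conj E(p) is the disc coordinate, centred at p, of the boundary fixed point e₁/e₂.
  set E : ℍ → ℂ := fun p => (e₁ : ℂ) - e₂ * p with hE
  have hEg : ∀ p, ν * (autFactor g p * E (g • p)) = E p := by
    intro p
    have hd := det_expand g
    have hcoe := coe_smul_mul g p
    have h5 : ν * (g.1 1 1 * e₁ - g.1 0 1 * e₂) = e₁ := by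
      linear_combination (-g.1 1 1) * hv0 + g.1 0 1 * hv1 + e₁ * hd
    have h6 : ν * (g.1 0 0 * e₂ - g.1 1 0 * e₁) = e₂ := by
      linear_combination (-g.1 0 0) * hv1 + g.1 1 0 * hv0 + e₂ * hd
    have h5' : (ν * (g.1 1 1 * e₁ - g.1 0 1 * e₂) : ℂ) = e₁ := by exact_mod_cast h5
    have h6' : (ν * (g.1 0 0 * e₂ - g.1 1 0 * e₁) : ℂ) = e₂ := by exact_mod_cast h6
    simp only [hE]
    calc _ = ν * (autFactor g p * e₁ - e₂ * (((g • p : ℍ) : ℂ) * autFactor g p)) := by ring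
      _ = ν * (g.1 1 1 * e₁ - g.1 0 1 * e₂) - ν * (g.1 0 0 * e₂ - g.1 1 0 * e₁) * p := by
        rw [hcoe, autFactor]; ring
      _ = _ := by rw [h5', h6']
  have hs_zero : s 0 = 1 := by simp [hs]
  set m : ℝ → ℝ := fun t => (k (t, 0) * conj (E (c t))).im with hm
  have hEc : Continuous fun t => E (c t) := by
    have := UpperHalfPlane.continuous_coe
    fun_prop
  have hmc : Continuous m := by
    have := hstar.comp hEc
    exact Complex.continuous_im.comp (Continuous.mul (by fun_prop) this)
  have hm1 : ν * ‖autFactor g (c 0)‖ * m 1 = - m 0 := by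
    have h1 := hσ (0, 0)
    simp only [zero_add, hσ1] at h1
    have h2 : c 1 = g • c 0 := by rw [← hper, zero_add]
    have h3 := congrArg conj (hEg (c 0))
    simp only [map_mul, Complex.conj_ofReal] at h3
    have h4 : conj (autFactor g (c 0))
        = conj (unitFactor g (c 0)) * (‖autFactor g (c 0)‖ : ℝ) := by
      rw [unitFactor, map_div₀, Complex.conj_ofReal,
        div_mul_cancel₀ _ (norm_autFactor_ne_zero g _)]
    have h5 : ((ν * ‖autFactor g (c 0)‖ : ℝ) : ℂ) * (k (1, 0) * conj (E (c 1)))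
        = - (k (0, 0) * conj (E (c 0))) := by
      rw [h1, ← h3, h4, h2]; push_cast; ring
    have h6 := congrArg Complex.im h5
    rw [Complex.im_ofReal_mul] at h6
    exact h6
  have hpos : 0 < ν * ‖autFactor g (c 0)‖ :=
    mul_pos hν0 (norm_pos_iff.2 (autFactor_ne_zero g _))
  -- Because σ = -1 and ν > 0, `m 1` is a negative multiple of `m 0`. At a zero of m, the root k(t,
  -- 0) is a real multiple of E, so the ray from c t through g • c t ends at e₁/e₂.
  obtain ⟨t, ht⟩ : ∃ t, m t = 0 := by
    rcases le_total (m 0) 0 with hle | hle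
    · have : 0 ≤ m 1 := by by_contra! hneg; nlinarith
      obtain ⟨t, -, ht⟩ := intermediate_value_Icc (zero_le_one' ℝ) hmc.continuousOn ⟨hle, this⟩
      exact ⟨t, ht⟩
    · have : m 1 ≤ 0 := by by_contra! hneg; nlinarith
      obtain ⟨t, -, ht⟩ := intermediate_value_Icc' (zero_le_one' ℝ) hmc.continuousOn ⟨this, hle⟩
      exact ⟨t, ht⟩
  set p := c t with hp
  have hEp : E p ≠ 0 := by
    intro h0
    have h1 := congrArg Complex.im h0
    have h2 := congrArg Complex.re h0
    have hp := p.im_pos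
    simp [hE] at h1 h2
    rcases h1 with h1 | h1
    · rw [h1] at h2; simp at h2; rcases he with he | he <;> contradiction
    · exact hp.ne' h1
  set x : ℝ := (k (t, 0) * conj (E p)).re with hx
  have hkx : k (t, 0) * conj (E p) = x := 
    Complex.ext rfl (ht.trans (Complex.ofReal_im x).symm)
  have hx0 : x ≠ 0 := by
    intro h1
    rw [h1] at hkx
    exact mul_ne_zero (hk0 _) (by simpa using hEp) hkx
  have hn : 0 < Complex.normSq (E p) := Complex.normSq_pos.2 hEp
  have hκ : discCoord p (g • p) = k (t, 0) ^ 2 := by rw [hk]; simp only [hs_zero, hper, hp]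
  have hray : discCoord p (g • p) * conj (E p) = ((x ^ 2 / Complex.normSq (E p) : ℝ) : ℂ) * E p := by
    have hcE : conj (E p) ≠ 0 := by simpa using hEp
    rw [hκ]
    push_cast
    rw [← hkx, ← Complex.mul_conj]
    field_simp
  have hlt := height_lt he (by positivity) hray
  have him : (g • p).im * Complex.normSq (autFactor g p) = p.im := by
    have h1 := congrArg Complex.im (congrArg (· * conj (autFactor g p)) (coe_smul_mul g p))
    rw [mul_assoc, Complex.mul_conj, Complex.im_mul_ofReal] at h1
    refine h1.trans ?_
    have hd := det_expand g
    simp [autFactor]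
    linear_combination p.im * hd
  -- With `him`, this says that g multiplies the height Im/|E|² by ν² ≤ 1, whereas `hlt` says that g
  -- strictly raises p.
  have hEn : ν ^ 2 * (Complex.normSq (autFactor g p) * Complex.normSq (E (g • p)))
      = Complex.normSq (E p) := by
    rw [← hEg p, map_mul, map_mul, Complex.normSq_ofReal]; ring
  have hj : 0 < Complex.normSq (autFactor g p) := Complex.normSq_pos.2 (autFactor_ne_zero g p)
  change p.im * Complex.normSq (E (g • p)) < (g • p).im * Complex.normSq (E p) at hlt
  have hEgp : 0 < Complex.normSq (E (g • p)) := by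
    apply Complex.normSq_pos.2
    intro h0
    have := hEg p
    rw [h0] at this
    exact hEp (by rw [← this]; ring)
  rw [← him, ← hEn] at hlt
  have hgim := (g • p).im_pos
  have hK : 0 < (g • p).im * Complex.normSq (autFactor g p) * Complex.normSq (E (g • p)) := by
    positivity
  have hν2 := mul_le_of_le_one_left hK.le (pow_le_one₀ hν0.le hν1 (n := 2))
  linarith

/-! ### The symmetric square and the hyperboloid model. -/

/-- The symmetric square of a unimodular matrix, in a basis adapted to the form `J`. -/
noncomputable def symSqMatrix (g : SpecialLinearGroup (Fin 2) ℝ) : Matrix (Fin 3) (Fin 3) ℝ :=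
  !![g.1 0 0 ^ 2, √2 * (g.1 0 0 * g.1 0 1), -g.1 0 1 ^ 2;
    √2 * (g.1 0 0 * g.1 1 0), g.1 0 0 * g.1 1 1 + g.1 0 1 * g.1 1 0, -(√2 * (g.1 0 1 * g.1 1 1));
    -g.1 1 0 ^ 2, -(√2 * (g.1 1 0 * g.1 1 1)), g.1 1 1 ^ 2]

theorem sqrt_two_sq : √2 ^ 2 = (2 : ℝ) := Real.sq_sqrt (by norm_num)

theorem det_symSqMatrix (g : SpecialLinearGroup (Fin 2) ℝ) : (symSqMatrix g).det = 1 := by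
  have hd := det_expand g
  have h2 := sqrt_two_sq
  have h3 : (symSqMatrix g).det = (g.1 0 0 * g.1 1 1 - g.1 0 1 * g.1 1 0) ^ 3 := by
    rw [det_fin_three]
    simp [symSqMatrix]
    ring_nf
    rw [h2]
    ring
  rw [h3, hd, one_pow]

theorem symSqMatrix_form (g : SpecialLinearGroup (Fin 2) ℝ) :
    (symSqMatrix g)ᵀ * J * symSqMatrix g = J := by
  have hd := det_expand g
  have h2 := sqrt_two_sq
  have hd2 : (g.1 0 0 * g.1 1 1 - g.1 0 1 * g.1 1 0) ^ 2 = 1 := by rw [hd, one_pow]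
  ext i j
  fin_cases i <;> fin_cases j <;>
    simp [symSqMatrix, J, Matrix.mul_apply, Fin.sum_univ_three] <;> ring_nf <;> (try rw [h2]) <;>
    linarith

/-- The symmetric square as an element of `SO(2,1)`. -/
noncomputable def symSq (g : SpecialLinearGroup (Fin 2) ℝ) : SO21 :=
  ⟨⟨symSqMatrix g, det_symSqMatrix g⟩, symSqMatrix_form g⟩

theorem trace_symSqMatrix (g : SpecialLinearGroup (Fin 2) ℝ) :
    (symSqMatrix g).trace = (g.1 0 0 + g.1 1 1) ^ 2 - 1 := by
  have hd := det_expand g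
  rw [trace_fin_three]
  simp [symSqMatrix]
  linear_combination -hd

theorem symSqMatrix_mul (g h : SpecialLinearGroup (Fin 2) ℝ) :
    symSqMatrix (g * h) = symSqMatrix g * symSqMatrix h := by
  have h2 := sqrt_two_sq
  ext i j
  fin_cases i <;> fin_cases j <;>
    simp [symSqMatrix, Matrix.mul_apply, Fin.sum_univ_three, Fin.sum_univ_two] <;> ring_nf <;>
    rw [h2]

theorem symSq_mul (g h : SpecialLinearGroup (Fin 2) ℝ) : symSq (g * h) = symSq g * symSq h :=
  Subtype.ext (Subtype.ext (symSqMatrix_mul g h))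

theorem symSq_inv (g : SpecialLinearGroup (Fin 2) ℝ) : symSq g⁻¹ = (symSq g)⁻¹ := by
  rw [eq_comm]
  apply inv_eq_of_mul_eq_one_right
  rw [← symSq_mul, mul_inv_cancel]
  apply Subtype.ext
  apply Subtype.ext
  ext i j
  fin_cases i <;> fin_cases j <;> simp [symSq, symSqMatrix]

theorem hypVec_form (p : ℍ) :
    (![-(p.re ^ 2 + p.im ^ 2) / (√2 * p.im), -p.re / p.im, 1 / (√2 * p.im)] : Fin 3 → ℝ) ⬝ᵥ
      (J *ᵥ ![-(p.re ^ 2 + p.im ^ 2) / (√2 * p.im), -p.re / p.im, 1 / (√2 * p.im)]) = -1 := by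
  have hp := p.im_pos.ne'
  have h2 := sqrt_two_sq
  have h0 : √2 ≠ 0 := by positivity
  simp [J, dotProduct, mulVec, Fin.sum_univ_three]
  field_simp
  rw [h2]
  ring

/-- The identification of the upper half plane with the hyperboloid. -/
noncomputable def toHyp (p : ℍ) : HypPlane :=
  ⟨![-(p.re ^ 2 + p.im ^ 2) / (√2 * p.im), -p.re / p.im, 1 / (√2 * p.im)], hypVec_form p, by
    have := p.im_pos
    simp
    positivity⟩

theorem symSqMatrix_mulVec (g : SpecialLinearGroup (Fin 2) ℝ) (p : ℍ) :
    symSqMatrix g *ᵥ (toHyp p).1 = (toHyp (g • p)).1 := by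
  have hj : 0 < Complex.normSq (autFactor g p) := Complex.normSq_pos.2 (autFactor_ne_zero g p)
  have hd := det_expand g
  have hy := p.im_pos
  have hy' := (g • p).im_pos
  have h0 : √2 ≠ 0 := by positivity
  have h2 := sqrt_two_sq
  have h1 := congrArg (· * conj (autFactor g p)) (coe_smul_mul g p)
  have him : (g • p).im * Complex.normSq (autFactor g p) = p.im := by
    have h1 := congrArg Complex.im h1
    rw [mul_assoc, Complex.mul_conj, Complex.im_mul_ofReal] at h1
    refine h1.trans ?_
    simp [autFactor]
    linear_combination p.im * hd
  have hre : (g • p).re * Complex.normSq (autFactor g p)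
      = g.1 0 0 * g.1 1 0 * (p.re ^ 2 + p.im ^ 2)
        + (g.1 0 0 * g.1 1 1 + g.1 0 1 * g.1 1 0) * p.re + g.1 0 1 * g.1 1 1 := by
    have h1 := congrArg Complex.re h1
    rw [mul_assoc, Complex.mul_conj, Complex.re_mul_ofReal] at h1
    refine h1.trans ?_
    simp [autFactor]
    ring
  have hN : Complex.normSq (autFactor g p) = (g.1 1 0) ^ 2 * (p.re ^ 2 + p.im ^ 2)
      + 2 * g.1 1 0 * g.1 1 1 * p.re + g.1 1 1 ^ 2 := by
    simp [autFactor, Complex.normSq_apply]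
    ring
  have hsq : ((g • p).re ^ 2 + (g • p).im ^ 2) * Complex.normSq (autFactor g p)
      = (g.1 0 0) ^ 2 * (p.re ^ 2 + p.im ^ 2)
      + 2 * g.1 0 0 * g.1 0 1 * p.re + g.1 0 1 ^ 2 := by
    have h1 := congrArg Complex.normSq (coe_smul_mul g p)
    rw [map_mul] at h1
    rw [Complex.normSq_apply ((g • p : ℍ) : ℂ)] at h1
    have h3 : Complex.normSq ((g.1 0 0 : ℂ) * p + g.1 0 1) = (g.1 0 0) ^ 2 * (p.re ^ 2 + p.im ^ 2)
        + 2 * g.1 0 0 * g.1 0 1 * p.re + g.1 0 1 ^ 2 := by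
      simp [Complex.normSq_apply]; ring
    rw [← h3, ← h1]
    simp only [UpperHalfPlane.coe_re, UpperHalfPlane.coe_im]
    ring
  set N := Complex.normSq (autFactor g p)
  set X := (g • p).re
  set Y := (g • p).im
  have e1 : (X ^ 2 + Y ^ 2) / Y = ((g.1 0 0) ^ 2 * (p.re ^ 2 + p.im ^ 2)
      + 2 * g.1 0 0 * g.1 0 1 * p.re + g.1 0 1 ^ 2) / p.im := by
    rw [← hsq, ← him]; field_simp
  have e2 : X / Y = (g.1 0 0 * g.1 1 0 * (p.re ^ 2 + p.im ^ 2)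
        + (g.1 0 0 * g.1 1 1 + g.1 0 1 * g.1 1 0) * p.re + g.1 0 1 * g.1 1 1) / p.im := by
    rw [← hre, ← him]; field_simp
  have e3 : 1 / Y = ((g.1 1 0) ^ 2 * (p.re ^ 2 + p.im ^ 2)
      + 2 * g.1 1 0 * g.1 1 1 * p.re + g.1 1 1 ^ 2) / p.im := by
    rw [← hN, ← him]; field_simp
  have f1 : -(X ^ 2 + Y ^ 2) / (√2 * Y) = -((X ^ 2 + Y ^ 2) / Y) / √2 := by field_simp
  have f2 : -X / Y = -(X / Y) := by ring
  have f3 : 1 / (√2 * Y) = (1 / Y) / √2 := by field_simp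
  simp only [toHyp]
  ext i
  fin_cases i
  · simp [symSqMatrix, mulVec, dotProduct, Fin.sum_univ_three]
    simp only [neg_add_rev] at f1
    rw [show (-Y ^ 2 + -X ^ 2) / (√2 * Y) = _ from f1, e1]
    field_simp
    ring_nf
    rw [h2]
    ring
  · simp [symSqMatrix, mulVec, dotProduct, Fin.sum_univ_three]
    rw [f2, e2]
    field_simp
    ring_nf
  · simp [symSqMatrix, mulVec, dotProduct, Fin.sum_univ_three]
    have f4 : Y⁻¹ * (√2)⁻¹ = (1 / Y) / √2 := by field_simp
    rw [f4, e3]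
    field_simp
    ring_nf
    rw [h2]
    ring

theorem smul_toHyp {A : SO21₀} {g : SpecialLinearGroup (Fin 2) ℝ} (h : A.1 = symSq g) (p : ℍ) :
    A • toHyp p = toHyp (g • p) := by
  apply Subtype.ext
  rw [← symSqMatrix_mulVec]
  change A.1.1.1 *ᵥ _ = _
  rw [h]
  rfl

/-- The identification of the upper half plane with the hyperboloid, as a homeomorphism. -/
noncomputable def hypHomeo : ℍ ≃ₜ HypPlane where
  toFun := toHyp
  invFun z := ⟨⟨-z.1 1 / (√2 * z.1 2), 1 / (√2 * z.1 2)⟩, by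
    have := z.2.2
    change 0 < 1 / (√2 * z.1 2)
    positivity⟩
  left_inv p := by
    have hp := p.im_pos.ne'
    apply UpperHalfPlane.ext
    apply Complex.ext
    · simp [toHyp]
      field_simp
    · simp [toHyp]
      field_simp
  right_inv z := by
    have hz := z.2.1
    have hz2 := z.2.2
    have h2 := sqrt_two_sq
    have h0 : √2 ≠ 0 := by positivity
    simp [J, dotProduct, mulVec, Fin.sum_univ_three] at hz
    apply Subtype.ext
    ext i
    fin_cases i
    · simp [toHyp, UpperHalfPlane.re, UpperHalfPlane.im]
      field_simp
      rw [h2]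
      linarith
    · simp [toHyp, UpperHalfPlane.re, UpperHalfPlane.im]
      field_simp
    · simp [toHyp, UpperHalfPlane.re, UpperHalfPlane.im]
      field_simp
  continuous_toFun := by
    refine Continuous.subtype_mk (continuous_pi fun i => ?_) _
    have h1 := UpperHalfPlane.continuous_re
    have h2 := UpperHalfPlane.continuous_im
    have h0 : √2 ≠ 0 := by positivity
    fin_cases i
    · exact Continuous.div (by fun_prop) (by fun_prop)
        fun p => mul_ne_zero h0 p.im_pos.ne'
    · exact Continuous.div (by fun_prop) (by fun_prop) fun p => p.im_pos.ne'
    · exact Continuous.div (by fun_prop) (by fun_prop)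
        fun p => mul_ne_zero h0 p.im_pos.ne'
  continuous_invFun := by
    rw [UpperHalfPlane.isEmbedding_coe.continuous_iff]
    have h0 : √2 ≠ 0 := by positivity
    have hv (i : Fin 3) : Continuous fun z : HypPlane => z.1 i :=
      (_root_.continuous_apply i).comp continuous_subtype_val
    have h1 : Continuous fun z : HypPlane => -z.1 1 / (√2 * z.1 2) :=
      Continuous.div (hv 1).neg (continuous_const.mul (hv 2)) fun z => mul_ne_zero h0 z.2.2.ne'
    have h2 : Continuous fun z : HypPlane => 1 / (√2 * z.1 2) :=
      Continuous.div (by fun_prop) (continuous_const.mul (hv 2)) fun z => mul_ne_zero h0 z.2.2.ne'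
    exact Complex.equivRealProdCLM.symm.continuous.comp (h1.prodMk h2)

/-- This is `last_pos` evaluated at the point i√t, with positive factors cleared. -/
theorem entry_lt (A : SO21₀) {t : ℝ} (ht : 0 < t) : A.1.1.1 2 0 * t < A.1.1.1 2 2 := by
  have hs := Real.sqrt_pos.2 ht
  have hs2 := Real.sq_sqrt ht.le
  have h := last_pos A (toHyp ⟨⟨0, √t⟩, hs⟩)
  simp [toHyp, mulVec, dotProduct, Fin.sum_univ_three, UpperHalfPlane.re, UpperHalfPlane.im] at h
  have h0 : 0 < √2 := by positivity
  have h3 := mul_pos (mul_pos h h0) hs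
  have e : A.1.1.1 2 2 - A.1.1.1 2 0 * t = (A.1.1.1 2 0 * (-t / (√2 * √t)) + A.1.1.1 2 2 * ((√t)⁻¹ * (√2)⁻¹)) * √2 * √t := by
    field_simp
    ring
  rw [hs2] at h3
  rw [← sub_pos, e]
  exact h3

theorem corner_signs (A : SO21₀) : A.1.1.1 2 0 ≤ 0 ∧ 0 ≤ A.1.1.1 2 2 := by
  set u := A.1.1.1 2 0
  set v := A.1.1.1 2 2
  have h : ∀ t, 0 < t → u * t < v := fun t ht => entry_lt A ht
  constructor
  · by_contra! hu
    have := h ((|v| + 1) / u) (by positivity)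
    rw [mul_div_cancel₀ _ hu.ne'] at this
    linarith [le_abs_self v]
  · by_contra! hv
    have h1 := h 1 one_pos
    have hu : u < 0 := by linarith
    -- This t is chosen so that u * t = v / 2, which would have to lie below the negative number v.
    have := h (v / (2 * u)) (div_pos_of_neg_of_neg hv (by linarith))
    have hu0 := hu.ne
    have e : u * (v / (2 * u)) = v / 2 := by field_simp
    linarith

/-- A pair of nonnegative numbers with the given mixed product comes from a vector. -/
theorem exists_sq_vector {m n l : ℝ} (hm : 0 ≤ m) (hn : 0 ≤ n) (h : l ^ 2 = 2 * (m * n)) :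
    ∃ a c : ℝ, a ^ 2 = m ∧ c ^ 2 = n ∧ √2 * (a * c) = l := by
  have h2 := sqrt_two_sq
  have hm2 := Real.sq_sqrt hm
  have hn2 := Real.sq_sqrt hn
  have h3 : l ^ 2 = (√2 * (√m * √n)) ^ 2 := by
    rw [mul_pow, mul_pow, h2, hm2, hn2, h]
  rcases sq_eq_sq_iff_eq_or_eq_neg.1 h3 with h4 | h4
  · exact ⟨√m, √n, hm2, hn2, h4.symm⟩
  · exact ⟨√m, -√n, hm2, by rw [neg_sq, hn2], by rw [h4]; ring⟩

theorem form_col {A : SO21} (i j : Fin 3) :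
    A.1.1 0 i * A.1.1 2 j + A.1.1 1 i * A.1.1 1 j + A.1.1 2 i * A.1.1 0 j = J i j := by
  have h : A.1.1ᵀ * J * A.1.1 = J := A.2
  rw [← congrFun (congrFun h i) j]
  simp [J, Matrix.mul_apply, Fin.sum_univ_three]
  ring

/-- Once the two isotropic basis vectors are fixed, the middle column is orthogonal to both, hence a
multiple of the middle basis vector, and the determinant makes the multiple 1. -/
theorem eq_one_of_cols {X : SO21} (h0 : X.1.1 *ᵥ Pi.single 0 1 = Pi.single 0 1)
    (h2 : X.1.1 *ᵥ Pi.single 2 1 = Pi.single 2 1) : X = 1 := by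
  have c0 := fun i => congrFun h0 i
  have c2 := fun i => congrFun h2 i
  simp only [mulVec_single_one, col_apply] at c0 c2
  have c00 := c0 0
  have c01 := c0 1
  have c02 := c0 2
  have c20 := c2 0
  have c21 := c2 1
  have c22 := c2 2
  simp at c00 c01 c02 c20 c21 c22
  have f01 := form_col (A := X) 0 1
  have f21 := form_col (A := X) 2 1
  simp [J, c00, c01, c02, c20, c21, c22] at f01 f21
  have hd := X.1.2
  rw [det_fin_three] at hd
  simp [c00, c01, c02, c20, c21, c22, f01, f21] at hd
  apply Subtype.ext
  apply Subtype.ext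
  ext i j
  fin_cases i <;> fin_cases j <;> simp [c00, c01, c02, c20, c21, c22, f01, f21, hd]

/-- The symmetric square maps onto `SO₀(2,1)`. -/
theorem exists_symSq_eq (A : SO21₀) : ∃ g : SpecialLinearGroup (Fin 2) ℝ, A.1 = symSq g := by
  obtain ⟨s0, s2⟩ := corner_signs A
  have f00 := form_col (A := A.1) 0 0
  have f02 := form_col (A := A.1) 0 2
  have f22 := form_col (A := A.1) 2 2
  simp [J] at f00 f02 f22
  set m : Matrix (Fin 3) (Fin 3) ℝ := A.1.1.1 with hm
  have h00 : 0 ≤ m 0 0 := by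
    rcases s0.lt_or_eq with h | h
    · by_contra! h1
      nlinarith [sq_nonneg (m 1 0), mul_pos_of_neg_of_neg h1 h]
    · have h1 : m 1 0 = 0 := by rw [h] at f00; simpa using f00
      rw [h, h1] at f02
      by_contra! h2
      nlinarith
  have h02 : m 0 2 ≤ 0 := by
    rcases s2.lt_or_eq with h | h
    · by_contra! h1
      nlinarith [sq_nonneg (m 1 2), mul_pos h1 h]
    · have h1 : m 1 2 = 0 := by rw [← h] at f22; simpa using f22
      rw [← h, h1] at f02
      by_contra! h2
      nlinarith
  -- The outer columns are isotropic with corner signs as in `symSqMatrix`, so each is, up to sign,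
  -- the square of a vector of ℝ². These two vectors are the candidate columns of g.
  obtain ⟨a, c, ha, hc, hac⟩ := exists_sq_vector (m := m 0 0) (n := -m 2 0) (l := m 1 0) h00
    (by linarith) (by linarith)
  obtain ⟨b, d, hb, hd, hbd⟩ := exists_sq_vector (m := -m 0 2) (n := m 2 2) (l := -m 1 2)
    (by linarith) s2 (by linarith)
  -- The J-product of the two outer columns equals this squared determinant.
  have hdet : (a * d - b * c) ^ 2 = 1 := by
    have h2 := sqrt_two_sq
    have e1 : m 1 2 = -(√2 * (b * d)) := by linarith
    have e2 : m 0 2 = -b ^ 2 := by linarith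
    have e3 : m 2 0 = -c ^ 2 := by linarith
    rw [← ha, ← hac, ← hd, e1, e2, e3] at f02
    linear_combination f02 + (a * c * b * d) * h2
  obtain ⟨g, hg00, hg10, hgb, hgd, hgbd⟩ : ∃ g : SpecialLinearGroup (Fin 2) ℝ, g.1 0 0 = a ∧
      g.1 1 0 = c ∧ g.1 0 1 ^ 2 = b ^ 2 ∧ g.1 1 1 ^ 2 = d ^ 2 ∧ g.1 0 1 * g.1 1 1 = b * d := by
    rcases sq_eq_sq_iff_eq_or_eq_neg.1 (hdet.trans (one_pow 2).symm) with h | h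
    · exact ⟨⟨!![a, b; c, d], by rw [det_fin_two_of, h]⟩, rfl, rfl, rfl, rfl, rfl⟩
    -- A square determines its vector only up to sign, so the second vector may be negated to
    -- correct the determinant.
    · refine ⟨⟨!![a, -b; c, -d], by rw [det_fin_two_of]; linarith⟩, rfl, rfl, ?_, ?_, ?_⟩ <;> simp
  refine ⟨g, ?_⟩
  have hinv : (symSq g)⁻¹ * A.1 = 1 := by
    have hmul : ((symSq g)⁻¹ * A.1).1.1 = ((symSq g)⁻¹).1.1 * m := rfl
    have hone : ((symSq g)⁻¹).1.1 * symSqMatrix g = 1 :=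
      congrArg (fun X : SO21 => X.1.1) (inv_mul_cancel (symSq g))
    have key : ∀ i : Fin 3, m *ᵥ Pi.single i 1 = symSqMatrix g *ᵥ Pi.single i 1 →
        ((symSq g)⁻¹ * A.1).1.1 *ᵥ Pi.single i 1 = Pi.single i 1 := by
      intro i hi
      rw [hmul, ← mulVec_mulVec, hi, mulVec_mulVec, hone, one_mulVec]
    apply eq_one_of_cols
    · apply key
      simp only [mulVec_single_one]
      ext i
      fin_cases i <;> simp [symSqMatrix, hg00, hg10] <;> linarith
    · apply key
      simp only [mulVec_single_one]
      ext i
      fin_cases i <;> simp [symSqMatrix, hgb, hgd, hgbd] <;> linarith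
  exact (inv_mul_eq_one.1 hinv).symm

/-! ### The injectivity radius, and existence of the spin structure. -/

/-- The injectivity radius of `F`, truncated at one. -/
noncomputable def injRadius {X Z : Type*} [PseudoMetricSpace X] (F : X → Z) (p : X) : ℝ :=
  sSup {r | 0 ≤ r ∧ r ≤ 1 ∧ Set.InjOn F (Metric.ball p r)}

section injRadius

variable {X Z : Type*} [PseudoMetricSpace X] {F : X → Z}

theorem bddAbove_injRadius (p : X) :
    BddAbove {r | 0 ≤ r ∧ r ≤ 1 ∧ Set.InjOn F (Metric.ball p r)} := ⟨1, fun _ hr => hr.2.1⟩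

theorem zero_mem_injRadius (p : X) :
    (0 : ℝ) ∈ {r | 0 ≤ r ∧ r ≤ 1 ∧ Set.InjOn F (Metric.ball p r)} :=
  ⟨le_rfl, zero_le_one, by simp⟩

theorem injRadius_nonneg (p : X) : 0 ≤ injRadius F p :=
  le_csSup (bddAbove_injRadius p) (zero_mem_injRadius p)

theorem injRadius_le_one (p : X) : injRadius F p ≤ 1 :=
  csSup_le ⟨0, zero_mem_injRadius p⟩ fun _ hr => hr.2.1

theorem injOn_ball_injRadius (p : X) : Set.InjOn F (Metric.ball p (injRadius F p)) := by
  intro q hq q' hq' h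
  obtain ⟨r, hr, hlt⟩ := exists_lt_of_lt_csSup ⟨0, zero_mem_injRadius p⟩
    (max_lt (Metric.mem_ball.1 hq) (Metric.mem_ball.1 hq'))
  exact hr.2.2 (Metric.mem_ball.2 ((le_max_left _ _).trans_lt hlt))
    (Metric.mem_ball.2 ((le_max_right _ _).trans_lt hlt)) h

theorem injRadius_pos (hF : ∀ p, ∃ U ∈ 𝓝 p, Set.InjOn F U) (p : X) : 0 < injRadius F p := by
  obtain ⟨U, hU, hinj⟩ := hF p
  obtain ⟨r, hr, hrU⟩ := Metric.mem_nhds_iff.1 hU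
  refine (lt_min hr one_pos).trans_le (le_csSup (bddAbove_injRadius p)
    ⟨(lt_min hr one_pos).le, min_le_right _ _, hinj.mono
      ((Metric.ball_subset_ball (min_le_left _ _)).trans hrU)⟩)

/-- A ball about q of radius r - dist p q lies inside the ball of radius r about p, so the function
is 1-Lipschitz. -/
theorem continuous_injRadius : Continuous (injRadius F) := by
  refine (LipschitzWith.of_le_add fun p q => ?_).continuous
  rw [← sub_le_iff_le_add]
  rcases le_total (injRadius F p - dist p q) 0 with h | h
  · exact h.trans (injRadius_nonneg q)
  · refine le_csSup (bddAbove_injRadius q) ⟨h, ?_, (injOn_ball_injRadius p).mono ?_⟩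
    · linarith [injRadius_le_one (F := F) p, dist_nonneg (x := p) (y := q)]
    · apply Metric.ball_subset_ball'
      rw [dist_comm q p]
      linarith

theorem injRadius_smul {G : Type*} [Group G] [MulAction G X] [IsIsometricSMul G X] {g : G}
    (hg : ∀ p, F (g • p) = F p) (p : X) : injRadius F (g • p) = injRadius F p := by
  unfold injRadius
  congr 1
  ext r
  simp only [Set.mem_ofPred]
  refine and_congr_right fun _ => and_congr_right fun _ => ⟨fun h q hq q' hq' e => ?_,
    fun h q hq q' hq' e => ?_⟩
  · apply smul_left_cancel g
    exact h (by simpa [Metric.mem_ball, dist_smul] using hq)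
      (by simpa [Metric.mem_ball, dist_smul] using hq') (by rw [hg, hg, e])
  · apply smul_left_cancel g⁻¹
    refine h ?_ ?_ ?_
    · rw [Metric.mem_ball, ← dist_smul g, smul_inv_smul]; exact hq
    · rw [Metric.mem_ball, ← dist_smul g, smul_inv_smul]; exact hq'
    · rw [← hg, smul_inv_smul, e, ← hg (g⁻¹ • q'), smul_inv_smul]

end injRadius

/-- A locally injective continuous function on the upper half plane admits a spinorial root. -/
theorem exists_spinStructure {F : ℍ → ℂ} (hF : Continuous F)
    (hloc : ∀ p, ∃ U ∈ 𝓝 p, Set.InjOn F U) :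
    ∃ (τ : ℍ → ℝ) (h : ℍ × ℍ → ℂ), Continuous τ ∧ (∀ p, 0 < τ p) ∧ ContinuousOn h (nearPairs τ) ∧
      (∀ x ∈ nearPairs τ, h x ^ 2 * discCoord x.1 x.2 = F x.2 - F x.1) ∧
      ∀ g : SpecialLinearGroup (Fin 2) ℝ, (∀ p, F (g • p) = F p) →
        (∀ p, τ (g • p) = τ p) ∧ (IsSpinLift τ h g ∨ IsSpinLift τ h (-g)) := by
  -- By `norm_discCoord`, tanh(r/2) is the Euclidean radius, in the disc coordinate, of the
  -- hyperbolic ball of radius r.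
  set τ : ℍ → ℝ := fun p => Real.tanh (injRadius F p / 2) with hτ
  have hc : Continuous τ := by
    have := continuous_injRadius (F := F)
    have ht : Continuous Real.tanh := by
      rw [show Real.tanh = fun x => Real.sinh x / Real.cosh x from
        funext Real.tanh_eq_sinh_div_cosh]
      exact Real.continuous_sinh.div Real.continuous_cosh fun x => (Real.cosh_pos x).ne'
    exact ht.comp (by fun_prop)
  have h0 : ∀ p, 0 < τ p := fun p => by
    simp only [hτ]
    have := injRadius_pos hloc p
    rw [Real.tanh_eq_sinh_div_cosh]
    exact div_pos (Real.sinh_pos_iff.2 (by linarith)) (Real.cosh_pos _)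
  have h1 : ∀ p, τ p ≤ 1 := fun p => (Real.tanh_lt_one _).le
  have hinj : ∀ p, Set.InjOn F {q | ‖discCoord p q‖ < τ p} := fun p =>
    (injOn_ball_injRadius p).mono fun q hq => by
      have hlt : Real.tanh (dist p q / 2) < Real.tanh (injRadius F p / 2) := by
        rwa [← norm_discCoord]
      have := Real.artanh_lt_artanh (Real.neg_one_lt_tanh _) (Real.tanh_lt_one _) hlt
      rw [Real.artanh_tanh, Real.artanh_tanh] at this
      rw [Metric.mem_ball, dist_comm]
      linarith
  obtain ⟨h, hh, hsq⟩ := exists_spinRoot hF hc h0 h1 hinj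
  refine ⟨τ, h, hc, h0, hh, hsq, fun g hg => ?_⟩
  have hg' : ∀ p, τ (g • p) = τ p := fun p => by simp only [hτ, injRadius_smul hg]
  exact ⟨hg', isSpinLift_or_neg hc h0 h1 hinj hh hsq hg hg'⟩

/-! ### Lifting circles to the universal cover. -/

/-- A circle around an omitted value does not lift to a closed curve. -/
theorem not_periodic_of_circle {F : ℍ → ℂ} (hF : Continuous F) {a z₀ ω : ℂ} (ha : ∀ p, F p ≠ a)
    (hω : ‖z₀ - a‖ < ‖ω‖) {c : ℝ → ℍ} (hc : Continuous c)
    (hFc : ∀ t : ℝ, F (c t) = z₀ + ω * Complex.exp (2 * Real.pi * t * Complex.I)) :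
    c 1 ≠ c 0 := by
  intro hper
  have hω0 : ω ≠ 0 := norm_pos_iff.1 ((norm_nonneg _).trans_lt hω)
  obtain ⟨k, hkc, hk⟩ := exists_sqrt (f := fun p => F p - a) (by fun_prop)
    fun p => sub_ne_zero.2 (ha p)
  set u : ℝ → ℂ := fun t => (z₀ - a) / ω * Complex.exp (-(2 * Real.pi * t * Complex.I)) with hu
  have hnu : ∀ t, ‖u t‖ < 1 := fun t => by
    have : Complex.exp (-(2 * Real.pi * t * Complex.I))
        = Complex.exp ((-(2 * Real.pi * t) : ℝ) * Complex.I) := by push_cast; congr 1; ring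
    simp only [hu]
    rw [this, norm_mul, Complex.norm_exp_ofReal_mul_I, mul_one, norm_div,
      div_lt_one (norm_pos_iff.2 hω0)]
    exact hω
  have hslit : ∀ t, 1 + u t ∈ Complex.slitPlane := fun t =>
    Complex.mem_slitPlane_of_norm_lt_one (hnu t)
  have huc : Continuous u := by fun_prop
  -- F(c t) - a = ω exp(2πit)(1 + u t) with |u t| < 1. The logarithm of 1 + u is therefore principal
  -- and periodic, and the root of F - a changes sign over a period; a closed lift c would force it
  -- to vanish.
  obtain ⟨ε, -, hε⟩ := exists_const_ratio (X := ℝ) (c := ω) (u := fun t => k (c t))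
    (v := fun t => Complex.exp (Complex.log (1 + u t) / 2) * Complex.exp (Real.pi * t * Complex.I))
    (by fun_prop)
    (by
      have : Continuous fun t => Complex.log (1 + u t) :=
        Continuous.clog (by fun_prop) hslit
      fun_prop)
    (fun t => mul_ne_zero (Complex.exp_ne_zero _) (Complex.exp_ne_zero _))
    (fun t => by
      rw [hk, hFc, mul_pow, ← Complex.exp_nat_mul, ← Complex.exp_nat_mul]
      have e1 : ((2 : ℕ) : ℂ) * (Complex.log (1 + u t) / 2) = Complex.log (1 + u t) := by
        push_cast; ring
      have e2 : ((2 : ℕ) : ℂ) * (Real.pi * t * Complex.I) = 2 * Real.pi * t * Complex.I := by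
        push_cast; ring
      rw [e1, e2, Complex.exp_log (Complex.slitPlane_ne_zero (hslit t))]
      simp only [hu]
      rw [Complex.exp_neg]
      have := Complex.exp_ne_zero (2 * Real.pi * t * Complex.I)
      field_simp
      ring)
  have e0 := hε 0
  have e1 := hε 1
  have hu1 : u 1 = u 0 := by
    simp only [hu]
    rw [Complex.exp_neg]
    simp [Complex.exp_two_pi_mul_I]
  rw [hu1] at e1
  simp only [hper, Complex.ofReal_one, mul_one, Complex.exp_pi_mul_I, Complex.ofReal_zero, mul_zero,
    zero_mul, Complex.exp_zero] at e0 e1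
  have h2 : k (c 0) = 0 := by
    have : k (c 0) = - k (c 0) := by
      calc k (c 0) = _ := e1
        _ = - (ε * Complex.exp (Complex.log (1 + u 0) / 2)) := by ring
        _ = _ := by rw [← e0]
    linear_combination this / 2
  have := hk (c 0)
  rw [h2] at this
  exact sub_ne_zero.2 (ha (c 0)) (by rw [← this]; ring)

/-- Lifting a free homotopy of loops, periodic in its first variable, to a covering space. -/
theorem exists_equivariant_lift {E Y : Type*} [TopologicalSpace E] [TopologicalSpace Y] {P : E → Y}
    (cov : IsCoveringMap P) {m : E → E} (hm : Continuous m) (hPm : ∀ e, P (m e) = P e)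
    {y₀ : Y} {e e' : E} (he : e' = m e) (c : Path e e') {a d : Path y₀ y₀}
    (hd : ∀ t, d t = P (c t)) (had : a.Homotopic d) {H : ℝ × ℝ → Y} (hH : Continuous H)
    (hper : ∀ t s, H (t + 1, s) = H (t, s)) (ha : ∀ t : unitInterval, a t = H (t, 0)) :
    ∃ K : ℝ × ℝ → E, Continuous K ∧ (∀ x, P (K x) = H x) ∧ ∀ t s, K (t + 1, s) = m (K (t, s)) := by
  have h0 : a 0 = P e := by rw [a.source, ← d.source, hd, c.source]
  have h00 : P e = H (0, 0) := by rw [← h0, ha]; simp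
  obtain ⟨K, ⟨hK0, hK⟩, -⟩ := cov.existsUnique_continuousMap_lifts (⟨H, hH⟩ : C(ℝ × ℝ, Y)) (0, 0) e h00
  have hKP : ∀ x, P (K x) = H x := fun x => congrFun hK x
  have hd0 : d 0 = P e := by rw [hd, c.source]
  have hend : K (1, 0) = e' := by
    have h1 := cov.liftPath_apply_one_eq_of_homotopicRel (γ₀ := a.toContinuousMap)
      (γ₁ := d.toContinuousMap) had e h0 hd0
    have h2 : c.toContinuousMap = cov.liftPath d.toContinuousMap e hd0 :=
      (cov.eq_liftPath_iff' _).2 ⟨funext fun t => (hd t).symm, c.source⟩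
    have h3 : (⟨fun t : unitInterval => K ((t : ℝ), 0), by fun_prop⟩ : C(unitInterval, E))
        = cov.liftPath a.toContinuousMap e h0 :=
      (cov.eq_liftPath_iff' _).2 ⟨funext fun t => (hKP _).trans (ha t).symm, by simpa using hK0⟩
    rw [← h2, ← h3] at h1
    simpa using h1
  refine ⟨K, K.continuous, hKP, fun t s => ?_⟩
  -- Both maps lift the same periodic homotopy and agree at (0, 0), so uniqueness of lifts gives
  -- equivariance everywhere.
  have h4 := cov.eq_of_comp_eq (g₁ := fun x : ℝ × ℝ => K (x.1 + 1, x.2)) (g₂ := fun x => m (K x))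
    (by fun_prop) (hm.comp K.continuous)
    (funext fun x => by simp only [Function.comp_apply, hPm, hKP, hper]) (0, 0)
    (by simp only [zero_add]; rw [hend, hK0, he])
  exact congrFun h4 (t, s)

section holonomy

variable {Y : Type*} [TopologicalSpace Y] {y₀ : Y} {ρ : FundamentalGroup Y y₀ →* SO21₀}
  (f : Quotient (MulAction.orbitRel ρ.range HypPlane) ≃ₜ Y) (φ : Y ≃ₜ stdPants)

/-- The developing projection from the upper half plane to the standard three holed sphere. -/
noncomputable def projToPlane (p : ℍ) : ℂ := φ (f (proj ρ.range (toHyp p)))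

variable {f φ}

theorem isCoveringMap_proj (hq : IsQuotientCoveringMap (proj ρ.range) ρ.range) :
    IsCoveringMap fun z => f (proj ρ.range z) :=
  IsQuotientCoveringMap.isCoveringMap _ _ (hq.homeomorph_comp f)

theorem continuous_projToPlane (hq : IsQuotientCoveringMap (proj ρ.range) ρ.range) :
    Continuous (projToPlane f φ) :=
  continuous_subtype_val.comp (φ.continuous.comp ((isCoveringMap_proj hq).continuous.comp
    hypHomeo.continuous))

theorem locallyInjective_projToPlane (hq : IsQuotientCoveringMap (proj ρ.range) ρ.range) (p : ℍ) :
    ∃ U ∈ 𝓝 p, Set.InjOn (projToPlane f φ) U := by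
  have h : IsLocalHomeomorph ((fun z => f (proj ρ.range z)) ∘ hypHomeo) :=
    (isCoveringMap_proj hq).isLocalHomeomorph.comp hypHomeo.isLocalHomeomorph
  obtain ⟨e, he, hfe⟩ := h p
  refine ⟨e.source, e.open_source.mem_nhds he, fun x hx y hy hxy => e.injOn hx hy ?_⟩
  rw [← hfe]
  exact φ.injective (Subtype.ext hxy)

theorem projToPlane_smul (hq : IsQuotientCoveringMap (proj ρ.range) ρ.range)
    {δ : FundamentalGroup Y y₀} {g : SpecialLinearGroup (Fin 2) ℝ} (hg : (ρ δ).1 = symSq g)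
    (p : ℍ) : projToPlane f φ (g • p) = projToPlane f φ p := by
  have h : proj ρ.range (ρ δ • toHyp p) = proj ρ.range (toHyp p) :=
    hq.map_smul ⟨ρ δ, δ, rfl⟩
  rw [projToPlane, ← smul_toHyp hg, h, projToPlane]

/-- The free homotopy H deforms the based loop to a round circle. Lifting it equivariantly gives a
curve over the circle that is translated by g⁻¹, to which `IsSpinLift.trace_neg` applies; g and g⁻¹
have equal traces. -/
theorem trace_neg_of_circle (hq : IsQuotientCoveringMap (proj ρ.range) ρ.range) {x₀ : HypPlane}
    {τ : ℍ → ℝ} {h : ℍ × ℍ → ℂ} (hτ : Continuous τ) (h0 : ∀ p, 0 < τ p)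
    (hh : ContinuousOn h (nearPairs τ))
    (hsq : ∀ x ∈ nearPairs τ,
      h x ^ 2 * discCoord x.1 x.2 = projToPlane f φ x.2 - projToPlane f φ x.1)
    {δ : FundamentalGroup Y y₀}
    (hpath : ∃ (c : Path (ρ δ • x₀) x₀) (d : Path y₀ y₀), (∀ t, d t = f (proj ρ.range (c t))) ∧
      FundamentalGroup.fromPath (Path.Homotopic.Quotient.mk d) = δ)
    {a : Path y₀ y₀} (hδ : δ = FundamentalGroup.fromPath (Path.Homotopic.Quotient.mk a))
    {H : ℝ × ℝ → ℂ} (hH : Continuous H) (hmem : ∀ x, H x ∈ stdPants)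
    (hper : ∀ t s, H (t + 1, s) = H (t, s)) (ha : ∀ t : unitInterval, (φ (a t) : ℂ) = H (t, 0))
    {z₀ ω v : ℂ} (hcirc : ∀ t : ℝ, H (t, 1) = z₀ + ω * Complex.exp (2 * Real.pi * t * Complex.I))
    (hv : v ∉ stdPants) (hω : ‖z₀ - v‖ < ‖ω‖)
    {g : SpecialLinearGroup (Fin 2) ℝ} (hg : (ρ δ).1 = symSq g) (hτg : ∀ p, τ (g • p) = τ p)
    (hspin : IsSpinLift τ h g) :
    g.1 0 0 + g.1 1 1 < 0 := by
  obtain ⟨c, d, hd, hdδ⟩ := hpath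
  have had : a.Homotopic d := Path.Homotopic.Quotient.exact (hδ.symm.trans hdδ.symm)
  have hcs : ContinuousConstSMul ρ.range HypPlane := hq.toContinuousConstSMul
  have hP : ∀ e, f (proj ρ.range ((ρ δ)⁻¹ • e)) = f (proj ρ.range e) := fun e =>
    congrArg f (hq.map_smul (e := e) ⟨(ρ δ)⁻¹, δ⁻¹, map_inv ρ δ⟩)
  obtain ⟨K, hK, hKP, hKper⟩ := exists_equivariant_lift (isCoveringMap_proj (f := f) hq)
    (m := fun z => (ρ δ)⁻¹ • z)
    (continuous_const_smul (⟨(ρ δ)⁻¹, δ⁻¹, map_inv ρ δ⟩ : ρ.range)) hP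
    (e := ρ δ • x₀) (e' := x₀) (inv_smul_smul _ _).symm c hd had
    (H := fun x => φ.symm ⟨H x, hmem x⟩) (by fun_prop)
    (fun t s => by simp only [hper]) (fun t => by
      apply φ.injective
      rw [φ.apply_symm_apply]
      exact Subtype.ext (ha t))
  set k : ℝ → ℍ := fun t => hypHomeo.symm (K (t, 1)) with hk
  have hkc : Continuous k := by fun_prop
  have htk : ∀ t, toHyp (k t) = K (t, 1) := fun t => hypHomeo.apply_symm_apply _
  have hinv : ((ρ δ)⁻¹).1 = symSq g⁻¹ := by
    rw [symSq_inv, ← hg]; rfl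
  have hkper : ∀ t, k (t + 1) = g⁻¹ • k t := by
    intro t
    apply hypHomeo.injective
    change toHyp (k (t + 1)) = toHyp (g⁻¹ • k t)
    rw [← smul_toHyp hinv, htk, htk, hKper]
  have hFk : ∀ t : ℝ, projToPlane f φ (k t)
      = z₀ + ω * Complex.exp (2 * Real.pi * t * Complex.I) := by
    intro t
    rw [projToPlane, htk, hKP, φ.apply_symm_apply]
    exact hcirc t
  -- The circle encloses the omitted value v, so its lift is not closed. Hence ρ δ ≠ 1, and freeness
  -- of the action excludes fixed points.
  have hne : k 1 ≠ k 0 := not_periodic_of_circle (continuous_projToPlane hq)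
    (fun p hp => hv (by rw [← hp]; exact (φ _).2)) hω hkc hFk
  have hfix : ∀ p : ℍ, g⁻¹ • p ≠ p := by
    intro p hp
    have h1 : (ρ δ)⁻¹ • toHyp p = toHyp p := by rw [smul_toHyp hinv, hp]
    have := hq.isCancelSMul
    have h2 : (⟨(ρ δ)⁻¹, δ⁻¹, map_inv ρ δ⟩ : ρ.range) = 1 := IsCancelSMul.eq_one_of_smul h1
    have h3 : (ρ δ)⁻¹ = 1 := congrArg Subtype.val h2
    apply hne
    apply hypHomeo.injective
    change toHyp (k 1) = toHyp (k 0)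
    rw [htk, htk, ← zero_add (1 : ℝ), hKper, h3, one_smul]
  have := (hspin.inv hτg).trace_neg hτ h0 hh hsq hfix hkc hkper
    (norm_pos_iff.1 ((norm_nonneg _).trans_lt hω)) hFk
  rw [SpecialLinearGroup.SL2_inv_expl] at this
  simp at this
  linarith

end holonomy

/-! ### Circles in the standard three holed sphere. -/

theorem leftCircle_mem {w : ℂ} (hw : ‖w‖ = 1) : -1 + w ∈ stdPants := by
  refine ⟨?_, ?_, ?_⟩
  · have := norm_add_le (-1 : ℂ) w
    rw [norm_neg, norm_one, hw] at this
    linarith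
  · rw [neg_add_cancel_comm, hw]; norm_num
  · have := norm_sub_norm_le (2 : ℂ) w
    rw [hw, Complex.norm_ofNat] at this
    rw [show -1 + w - 1 = -(2 - w) by ring, norm_neg]
    linarith

theorem neg_mem_stdPants {z : ℂ} (hz : z ∈ stdPants) : -z ∈ stdPants := by
  refine ⟨by rw [norm_neg]; exact hz.1, ?_, ?_⟩
  · rw [show -z + 1 = -(z - 1) by ring, norm_neg]; exact hz.2.2
  · rw [show -z - 1 = -(z + 1) by ring, norm_neg]; exact hz.2.1

/-- Since |2iwr ± 1|² = 1 + 4r² ∓ 4r Im w, the bound r ≥ |Im w| keeps the point at distance at least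
1 from both ±1. -/
theorem radial_mem {w : ℂ} (hw : ‖w‖ = 1) {r : ℝ} (h1 : |w.im| ≤ r) (h2 : r ≤ 1) :
    2 * Complex.I * w * r ∈ stdPants := by
  have hr0 : 0 ≤ r := (abs_nonneg _).trans h1
  have hn : w.re ^ 2 + w.im ^ 2 = 1 := by
    have := Complex.normSq_eq_norm_sq w
    rw [hw, Complex.normSq_apply] at this
    linarith
  have h3 := abs_le.1 h1
  have key : ∀ z : ℂ, 1 ≤ Complex.normSq z → 1 / 2 < ‖z‖ := by
    intro z hz
    rw [Complex.normSq_eq_norm_sq] at hz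
    nlinarith [norm_nonneg z]
  refine ⟨?_, key _ ?_, key _ ?_⟩
  · rw [norm_mul, norm_mul, norm_mul, hw, Complex.norm_I, Complex.norm_real,
      Real.norm_of_nonneg hr0, Complex.norm_ofNat]
    linarith
  · have := mul_nonneg hr0 (sub_nonneg.2 h3.2)
    simp [Complex.normSq_apply]
    linear_combination 4 * this - 4 * r ^ 2 * hn
  · have := mul_nonneg hr0 (neg_le_iff_add_nonneg.1 h3.1)
    simp [Complex.normSq_apply]
    linear_combination 4 * this - 4 * r ^ 2 * hn

theorem two_I_mul_im (w : ℂ) : 2 * Complex.I * w.im = w - conj w := by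
  rw [Complex.sub_conj]; push_cast; ring

/-- The free homotopy from the concatenation of the two inner circles to a circle around both. -/
noncomputable def outerHomotopy (x : ℝ × ℝ) : ℂ :=
  2 * Complex.I * Complex.exp (2 * Real.pi * x.1 * Complex.I) *
    (((1 - max 0 (min x.2 1)) * |(Complex.exp (2 * Real.pi * x.1 * Complex.I)).im|
      + max 0 (min x.2 1) : ℝ) : ℂ)

theorem norm_exp_two_pi (t : ℝ) : ‖Complex.exp (2 * Real.pi * t * Complex.I)‖ = 1 := by
  have := Complex.norm_exp_ofReal_mul_I (2 * Real.pi * t)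
  push_cast at this
  exact this

theorem exp_two_pi_add_one (t : ℝ) : Complex.exp (2 * Real.pi * ((t + 1 : ℝ) : ℂ) * Complex.I)
    = Complex.exp (2 * Real.pi * t * Complex.I) := by
  push_cast
  rw [mul_add, add_mul, mul_one, Complex.exp_add, Complex.exp_two_pi_mul_I, mul_one]

theorem outerHomotopy_mem (x : ℝ × ℝ) : outerHomotopy x ∈ stdPants := by
  have hw := norm_exp_two_pi x.1
  have him : |(Complex.exp (2 * Real.pi * x.1 * Complex.I)).im| ≤ 1 :=
    (Complex.abs_im_le_norm _).trans hw.le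
  have h0 : 0 ≤ max 0 (min x.2 1) := le_max_left _ _
  have h1 : max 0 (min x.2 1) ≤ 1 := max_le zero_le_one (min_le_right _ _)
  exact radial_mem hw (by nlinarith) (by nlinarith)

theorem im_exp_two_pi (t : ℝ) :
    (Complex.exp (2 * Real.pi * t * Complex.I)).im = Real.sin (2 * Real.pi * t) := by
  have := Complex.exp_ofReal_mul_I_im (2 * Real.pi * t)
  push_cast at this
  exact this

theorem exp_double (t : ℝ) : Complex.exp (2 * Real.pi * ((2 * t : ℝ) : ℂ) * Complex.I)
    = Complex.exp (2 * Real.pi * t * Complex.I) ^ 2 := by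
  rw [← Complex.exp_nat_mul]; congr 1; push_cast; ring

theorem outerHomotopy_zero (t : ℝ) : outerHomotopy (t, 0)
    = 2 * Complex.I * Complex.exp (2 * Real.pi * t * Complex.I) *
      ((|(Complex.exp (2 * Real.pi * t * Complex.I)).im| : ℝ) : ℂ) := by
  simp [outerHomotopy]

theorem exp_mul_conj (t : ℝ) : Complex.exp (2 * Real.pi * t * Complex.I) *
    conj (Complex.exp (2 * Real.pi * t * Complex.I)) = 1 := by
  rw [Complex.mul_conj, Complex.normSq_eq_norm_sq, norm_exp_two_pi]; simp

/-- In polar form, 2i Im w = w - conj w gives 2iw Im w = w² - 1 for |w| = 1. The figure eight is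
thus the radial graph 2iw|Im w|, which is pushed outwards to the circle 2iw. -/
theorem outerHomotopy_zero_left {t : ℝ} (h0 : 0 ≤ t) (h1 : t ≤ 1 / 2) : outerHomotopy (t, 0)
    = -1 + Complex.exp (2 * Real.pi * ((2 * t : ℝ) : ℂ) * Complex.I) := by
  have hs : 0 ≤ Real.sin (2 * Real.pi * t) :=
    Real.sin_nonneg_of_nonneg_of_le_pi (by positivity) (by nlinarith [Real.pi_pos])
  rw [outerHomotopy_zero, exp_double, im_exp_two_pi, abs_of_nonneg hs, ← im_exp_two_pi]
  have h2 := two_I_mul_im (Complex.exp (2 * Real.pi * t * Complex.I))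
  have h3 := exp_mul_conj t
  linear_combination Complex.exp (2 * Real.pi * t * Complex.I) * h2 - h3

theorem outerHomotopy_zero_right {t : ℝ} (h0 : 1 / 2 ≤ t) (h1 : t ≤ 1) : outerHomotopy (t, 0)
    = 1 - Complex.exp (2 * Real.pi * ((2 * t - 1 : ℝ) : ℂ) * Complex.I) := by
  have hs : 0 ≤ Real.sin (2 * Real.pi * t - Real.pi) :=
    Real.sin_nonneg_of_nonneg_of_le_pi (by nlinarith [Real.pi_pos]) (by nlinarith [Real.pi_pos])
  rw [Real.sin_sub_pi] at hs
  rw [← exp_two_pi_add_one (2 * t - 1), sub_add_cancel, outerHomotopy_zero, exp_double,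
    im_exp_two_pi, abs_of_nonpos (by linarith), ← im_exp_two_pi]
  have h2 := two_I_mul_im (Complex.exp (2 * Real.pi * t * Complex.I))
  have h3 := exp_mul_conj t
  push_cast
  linear_combination (-Complex.exp (2 * Real.pi * t * Complex.I)) * h2 + h3

theorem left_not_mem : (-1 : ℂ) ∉ stdPants := fun h => by
  have := h.2.1
  norm_num at this

theorem right_not_mem : (1 : ℂ) ∉ stdPants := fun h => by
  have := h.2.2
  norm_num at this

/-- The spin lifts of the boundary holonomies of a hyperbolic three holed sphere have negative
traces. -/
theorem exists_lifts_trace_neg {Y : Type*} [TopologicalSpace Y] {y₀ : Y}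
    {α β γ : FundamentalGroup Y y₀} (hY : IsThreeHoledSphere α β γ)
    {ρ : FundamentalGroup Y y₀ →* SO21₀} (hρ : IsFuchsian ρ) :
    ∃ a b : SpecialLinearGroup (Fin 2) ℝ, (ρ α).1 = symSq a ∧ (ρ β).1 = symSq b ∧
      a.1 0 0 + a.1 1 1 < 0 ∧ b.1 0 0 + b.1 1 1 < 0 ∧ (b * a).1 0 0 + (b * a).1 1 1 < 0 := by
  obtain ⟨φ, la, lb, hla, hlb, hα, hβ, -⟩ := hY
  obtain ⟨hq, f, x₀, -, hpath⟩ := hρ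
  obtain ⟨τ, h, hτ, h0, hh, hsq, hspin⟩ := exists_spinStructure
    (continuous_projToPlane (f := f) (φ := φ) hq) (locallyInjective_projToPlane hq)
  have hlift : ∀ δ : FundamentalGroup Y y₀, ∃ g : SpecialLinearGroup (Fin 2) ℝ,
      (ρ δ).1 = symSq g ∧ IsSpinLift τ h g := by
    intro δ
    obtain ⟨g, hg⟩ := exists_symSq_eq (ρ δ)
    rcases (hspin g (projToPlane_smul hq hg)).2 with h1 | h1
    · exact ⟨g, hg, h1⟩
    · refine ⟨-g, hg.trans ?_, h1⟩
      apply Subtype.ext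
      apply Subtype.ext
      simp [symSq, symSqMatrix]
  have hinv : ∀ (δ : FundamentalGroup Y y₀) (g : SpecialLinearGroup (Fin 2) ℝ),
      (ρ δ).1 = symSq g → ∀ p, τ (g • p) = τ p := fun δ g hg =>
    (hspin g (projToPlane_smul hq hg)).1
  obtain ⟨a, ha, hsa⟩ := hlift α
  obtain ⟨b, hb, hsb⟩ := hlift β
  have hba : (ρ (β * α)).1 = symSq (b * a) := by
    rw [symSq_mul, ← ha, ← hb, map_mul]; rfl
  refine ⟨a, b, ha, hb, ?_, ?_, ?_⟩
  · refine trace_neg_of_circle hq hτ h0 hh hsq (hpath α) hα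
      (H := fun x => -1 + Complex.exp (2 * Real.pi * x.1 * Complex.I)) (by fun_prop)
      (fun x => leftCircle_mem (norm_exp_two_pi _)) (fun t s => by simp only [exp_two_pi_add_one])
      hla (z₀ := -1) (ω := 1) (fun t => by rw [one_mul]) left_not_mem (by simp) ha
      (hinv _ _ ha) hsa
  · refine trace_neg_of_circle hq hτ h0 hh hsq (hpath β) hβ
      (H := fun x => 1 - Complex.exp (2 * Real.pi * x.1 * Complex.I)) (by fun_prop)
      (fun x => ?_) (fun t s => by simp only [exp_two_pi_add_one])
      hlb (z₀ := 1) (ω := -1) (fun t => by ring) right_not_mem (by simp) hb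
      (hinv _ _ hb) hsb
    have := neg_mem_stdPants (leftCircle_mem (norm_exp_two_pi x.1))
    rwa [neg_add, neg_neg, ← sub_eq_add_neg] at this
  · have hab : β * α = FundamentalGroup.fromPath (Path.Homotopic.Quotient.mk (la.trans lb)) := by
      rw [hα, hβ]; rfl
    -- The final circle has centre 0 and radius 2, and it encloses the omitted value 1.
    refine trace_neg_of_circle hq hτ h0 hh hsq (hpath (β * α)) hab
      (H := outerHomotopy) (by unfold outerHomotopy; fun_prop) outerHomotopy_mem
      (fun t s => by simp only [outerHomotopy, exp_two_pi_add_one])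
      (fun t => ?_) (z₀ := 0) (ω := 2 * Complex.I)
      (fun t => by simp [outerHomotopy]) right_not_mem (by simp) hba
      (hinv _ _ hba) (hsb.mul hsa (hinv _ _ ha))
    rw [Path.trans_apply]
    split_ifs with ht
    · rw [hla, outerHomotopy_zero_left t.2.1 ht]
    · rw [hlb, outerHomotopy_zero_right (not_le.1 ht).le t.2.2]

/-! ### Trace identities in SL(2,ℝ). -/

theorem tr_symSq (g : SpecialLinearGroup (Fin 2) ℝ) :
    tr (symSq g).1 = (g.1 0 0 + g.1 1 1) ^ 2 - 1 := trace_symSqMatrix g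

theorem coe_inv_symSq (g : SpecialLinearGroup (Fin 2) ℝ) : (symSq g).1⁻¹ = (symSq g⁻¹).1 := by
  rw [symSq_inv]; rfl

theorem coe_mul_symSq (g h : SpecialLinearGroup (Fin 2) ℝ) :
    (symSq g).1 * (symSq h).1 = (symSq (g * h)).1 := by
  rw [symSq_mul]; rfl

theorem trace_inv_fin_two (g : SpecialLinearGroup (Fin 2) ℝ) :
    (g⁻¹).1 0 0 + (g⁻¹).1 1 1 = g.1 0 0 + g.1 1 1 := by
  rw [SL2_inv_expl]; simp [add_comm]

/-- By Cayley-Hamilton, g⁻¹ = (tr g) I - g; multiply by h and take traces. -/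
theorem trace_inv_mul_fin_two (g h : SpecialLinearGroup (Fin 2) ℝ) :
    (g⁻¹ * h).1 0 0 + (g⁻¹ * h).1 1 1 = (g.1 0 0 + g.1 1 1) * (h.1 0 0 + h.1 1 1)
      - ((h * g).1 0 0 + (h * g).1 1 1) := by
  rw [show (g⁻¹ * h).1 = g.1.adjugate * h.1 from rfl, show (h * g).1 = h.1 * g.1 from rfl,
    adjugate_fin_two]
  simp [Matrix.mul_apply, Fin.sum_univ_two]
  ring

theorem trace_commutator_fin_two (g h : SpecialLinearGroup (Fin 2) ℝ) :
    (g * h * g⁻¹ * h⁻¹).1 0 0 + (g * h * g⁻¹ * h⁻¹).1 1 1 = (g.1 0 0 + g.1 1 1) ^ 2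
      + (h.1 0 0 + h.1 1 1) ^ 2 + ((h * g).1 0 0 + (h * g).1 1 1) ^ 2
      - (g.1 0 0 + g.1 1 1) * (h.1 0 0 + h.1 1 1) * ((h * g).1 0 0 + (h * g).1 1 1) - 2 := by
  have hg := det_expand g
  have hh := det_expand h
  rw [show (g * h * g⁻¹ * h⁻¹).1 = g.1 * h.1 * g.1.adjugate * h.1.adjugate from rfl,
    show (h * g).1 = h.1 * g.1 from rfl, adjugate_fin_two, adjugate_fin_two]
  simp [Matrix.mul_apply, Fin.sum_univ_two]
  linear_combination (g.1 0 0 + g.1 1 1) ^ 2 * hh + (h.1 0 0 + h.1 1 1) ^ 2 * hg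
    - 2 * (hg * (h.1 0 0 * h.1 1 1 - h.1 0 1 * h.1 1 0) + hh)

end Pants

open Pants in
theorem proposition5p10 {Y : Type*} [TopologicalSpace Y] {y₀ : Y}
    (α β γ : FundamentalGroup Y y₀) (hY : IsThreeHoledSphere α β γ)
    (ρ : FundamentalGroup Y y₀ →* SO21₀) (hρ : IsFuchsian ρ)
    (A B C : Matrix.SpecialLinearGroup (Fin 3) ℝ)
    (hA : A = toSL (ρ α)) (hB : B = toSL (ρ β)) (hC : C = toSL (ρ γ)) :
    0 < (tr A + 1) * (tr B + 1) * (tr C + 1) ∧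
    shapePlus A B C = tr A + tr B + tr C + 1
      + 2 * Real.sqrt ((tr A + 1) * (tr B + 1) * (tr C + 1)) ∧
    shapeMinus A B C = tr A + tr B + tr C + 1
      + 2 * Real.sqrt ((tr A + 1) * (tr B + 1) * (tr C + 1)) ∧
    tr (A * B * A⁻¹ * B⁻¹) = (tr A + tr B + tr C + 1
      + Real.sqrt ((tr A + 1) * (tr B + 1) * (tr C + 1))) ^ 2 - 1 := by
  obtain ⟨a, b, ha, hb, hx, hy, hz⟩ := exists_lifts_trace_neg hY hρ
  have hγ : γ = (β * α)⁻¹ := by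
    obtain ⟨_, _, _, _, _, _, _, h⟩ := hY
    rw [mul_assoc] at h
    exact eq_inv_of_mul_eq_one_left h
  have hA' : A = (symSq a).1 := by rw [hA, ← ha]; rfl
  have hB' : B = (symSq b).1 := by rw [hB, ← hb]; rfl
  have hC' : C = (symSq (b * a)⁻¹).1 := by
    rw [← coe_inv_symSq, ← coe_mul_symSq, ← hA', ← hB', hA, hB, hC, hγ, map_inv, map_mul]
    rfl
  subst hA' hB' hC'
  have hz' := trace_inv_fin_two (b * a)
  have e1 := trace_inv_mul_fin_two a b
  have e2 := trace_inv_mul_fin_two b a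
  have hcomm : (a * b).1 0 0 + (a * b).1 1 1 = (b * a).1 0 0 + (b * a).1 1 1 := by
    simp [Matrix.mul_apply, Fin.sum_univ_two]; ring
  have e3 := trace_commutator_fin_two a b
  rw [hcomm] at e2
  simp only [shapePlus, shapeMinus, coe_inv_symSq, coe_mul_symSq, tr_symSq, hz', e1, e2, e3,
    trace_inv_fin_two]
  generalize a.1 0 0 + a.1 1 1 = x at *
  generalize b.1 0 0 + b.1 1 1 = y at *
  generalize (b * a).1 0 0 + (b * a).1 1 1 = z at *
  -- This is the only geometric input. It selects -xyz as the positive root, after which the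
  -- formulas are polynomial identities.
  have hxyz : x * y * z < 0 := mul_neg_of_pos_of_neg (mul_pos_of_neg_of_neg hx hy) hz
  have hsqrt : √((x ^ 2 - 1 + 1) * (y ^ 2 - 1 + 1) * (z ^ 2 - 1 + 1)) = -(x * y * z) := by
    rw [show (x ^ 2 - 1 + 1) * (y ^ 2 - 1 + 1) * (z ^ 2 - 1 + 1) = (-(x * y * z)) ^ 2 by ring,
      Real.sqrt_sq (by linarith)]
  rw [hsqrt]
  refine ⟨?_, by ring, by ring, by ring⟩
  have hx0 := hx.ne
  have hy0 := hy.ne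
  have hz0 := hz.ne
  simp only [sub_add_cancel]
  positivity
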